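/- Let $\varepsilon=\pm1$, let $N\subset\mathbb{R}^3$ be open with coordinates $(t,x,y)$, and let $f=f(x,y)$ be smooth on the image of $N$ under $(t,x,y)\mapsto(x,y)$. Equip $N$ with the Walker metric $g=\varepsilon\,dx^2+f(x,y)\,dy^2+2\,dt\,dy$, and suppose that $f_{xx}$ does not vanish identically on any non-empty open subset of $N$. A metric is called locally conformally flat on a set if every point of the set has an open neighbourhood on which some metric $e^{2\varphi}g$, $\varphi$ smooth, has vanishing curvature tensor. (A) For every open $U\subset N$, the metric $g$ is locally conformally flat on $U$ if and only if $f_{xxx}=0$ on $U$, that is, if and only if $f$ is locally quadratic in $x$. (B) Let $\Sigma\subset N$ be a connected smooth surface (embedded or immersed), non-degenerate (the induced metric is non-degenerate at every point) and totally umbilical: locally, for a smooth unit normal field $\mathcal V$ with $\langle\mathcal V,\mathcal V\rangle=\delta=\pm1$ there is a smooth function $\lambda$ with $-\overline\nabla_T\mathcal V=\lambda T$ for all tangent vectors $T$ of $\Sigma$. Then one of the following holds. 1. $\Sigma$ belongs to the family of parallel surfaces of Calvaruso and Van der Veken, that is, the surfaces which near every point are of the form $\{(u,x(v),v)\}$ with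 $x''(v)-\tfrac{\varepsilon}{2}f_x(x(v),v)=C$ for a constant $C$; moreover $C=0$ and $\Sigma$ is totally geodesic. 2. The points of $\Sigma$ at which $\partial_t$ is not tangent to $\Sigma$ form a dense open subset $\Sigma^\circ$ of $\Sigma$; the set $N^\circ$ of all points of $N$ that have the same $(x,y)$ as some point of $\Sigma^\circ$ is open; and $(N^\circ,g)$ is locally conformally flat, with $f_{xxx}=0$ on $N^\circ$. (C) Suppose in addition that $N$ does not have regions of different type, in the sense that $(N,g)$ is locally conformally flat as soon as it is so on some non-empty open subset; or suppose that $N$ is connected and $f$ is real-analytic. Then in (B) either alternative 1 holds, or the whole of $(N,g)$ is locally conformally flat and $f_{xxx}=0$ on $N$. -/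

import Mathlib

open scoped Manifold ContDiff

noncomputable section

/-- The coordinate space with coordinates `(t, x, y)`, carried by the indices `0, 1, 2`. -/
abbrev Space3 : Type := Fin 3 → ℝ

/-- The coordinate vector field `∂_t`. -/
def dt : Space3 := Pi.single 0 1

/-- A (pseudo-Riemannian) metric in coordinates: its Gram matrix at every point. -/
abbrev Metric3 : Type := Space3 → Matrix (Fin 3) (Fin 3) ℝ

/-- The Walker metric `ε dx² + f(x,y) dy² + 2 dt dy`. -/
def walkerMetric (ε : ℝ) (f : ℝ → ℝ → ℝ) : Metric3 :=
  fun p => !![0, 0, 1; 0, ε, 0; 1, 0, f (p 1) (p 2)]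

/-- The product `⟨u, v⟩` at the point `p`. -/
def Metric3.pair (G : Metric3) (p u v : Space3) : ℝ :=
  ∑ i, ∑ j, G p i j * u i * v j

/-- The partial derivative `∂_i F` at `p`. -/
def pderiv3 (i : Fin 3) (F : Space3 → ℝ) (p : Space3) : ℝ :=
  fderiv ℝ F p (Pi.single i 1)

/-- The Christoffel symbol `Γ^k_{ij}` of the Levi-Civita connection. -/
def Metric3.christoffel (G : Metric3) (k i j : Fin 3) (p : Space3) : ℝ :=
  (1 / 2) * ∑ l, (G p)⁻¹ k l *
    (pderiv3 i (fun q => G q j l) p + pderiv3 j (fun q => G q i l) p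
      - pderiv3 l (fun q => G q i j) p)

/-- The component `R^l_{kij}` of the curvature: the `l`-th component of `Rm(∂_i, ∂_j) ∂_k`, where
`Rm(X,Y)Z = [∇_X, ∇_Y] Z - ∇_{[X,Y]} Z`. -/
def Metric3.riemann (G : Metric3) (l k i j : Fin 3) (p : Space3) : ℝ :=
  pderiv3 i (G.christoffel l j k) p - pderiv3 j (G.christoffel l i k) p
    + ∑ m, (G.christoffel l i m p * G.christoffel m j k p
      - G.christoffel l j m p * G.christoffel m i k p)

/-- The metric is flat on `U`: its curvature tensor vanishes there. -/
def Metric3.IsFlatOn (G : Metric3) (U : Set Space3) : Prop :=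
  ∀ p ∈ U, ∀ l k i j, G.riemann l k i j p = 0

/-- The metric is locally conformally flat on `N`: every point of `N` has an open neighbourhood
on which a conformal metric `exp(2φ) G`, with `φ` smooth, is flat. -/
def Metric3.IsLocallyConformallyFlatOn (G : Metric3) (N : Set Space3) : Prop :=
  ∀ p ∈ N, ∃ U ⊆ N, IsOpen U ∧ p ∈ U ∧ ∃ φ : Space3 → ℝ, ContDiffOn ℝ ∞ φ U ∧
    Metric3.IsFlatOn (fun q => Real.exp (2 * φ q) • G q) U

/-- The domain of the coordinates `(x, y)` over `N`. -/
def xyImage (N : Set Space3) : Set (ℝ × ℝ) := (fun p : Space3 => (p 1, p 2)) '' N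

/-- The `n`-th partial derivative of `f(x,y)` in the variable `x`, as a function on the space. -/
def xDeriv (n : ℕ) (f : ℝ → ℝ → ℝ) (p : Space3) : ℝ :=
  iteratedDeriv n (fun x => f x (p 2)) (p 1)

section Surface

variable {M : Type*} [TopologicalSpace M] [ChartedSpace (EuclideanSpace ℝ (Fin 2)) M]

/-- The differential of `V : M → ℝ³` at `m` applied to the tangent vector `T`. -/
def surfDeriv (V : M → Space3) (m : M) (T : TangentSpace (𝓡 2) m) : Space3 :=
  mfderiv (𝓡 2) 𝓘(ℝ, Space3) V m T

/-- The smooth map `ι` from the two-manifold `M` takes values in `N` and the induced bilinear form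
is non-degenerate at every point. In particular `ι` is an immersion. -/
structure IsNondegenerateSurface (G : Metric3) (N : Set Space3) (ι : M → Space3) : Prop where
  smooth : ContMDiff (𝓡 2) 𝓘(ℝ, Space3) ∞ ι
  mem : ∀ m, ι m ∈ N
  nondegenerate : ∀ (m : M) (T : TangentSpace (𝓡 2) m),
    (∀ T' : TangentSpace (𝓡 2) m, G.pair (ι m) (surfDeriv ι m T) (surfDeriv ι m T') = 0) → T = 0

/-- The ambient covariant derivative `∇_T V` of a vector field `V` along `ι`. -/
def covDerivAlong (G : Metric3) (ι V : M → Space3) (m : M) (T : TangentSpace (𝓡 2) m) : Space3 :=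
  fun k => surfDeriv V m T k
    + ∑ i, ∑ j, G.christoffel k i j (ι m) * surfDeriv ι m T i * V m j

/-- `V` is, over `W`, a smooth normal field of `ι` with `⟨V, V⟩ = δ`, `δ = ±1`. -/
structure IsUnitNormalOn (G : Metric3) (ι : M → Space3) (W : Set M) (V : M → Space3) (δ : ℝ) :
    Prop where
  sign : δ = 1 ∨ δ = -1
  smooth : ContMDiffOn (𝓡 2) 𝓘(ℝ, Space3) ∞ V W
  normal : ∀ m ∈ W, ∀ T : TangentSpace (𝓡 2) m, G.pair (ι m) (surfDeriv ι m T) (V m) = 0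
  unit : ∀ m ∈ W, G.pair (ι m) (V m) (V m) = δ

/-- `ι` is totally umbilical: near every point there are a unit normal field `V` and a smooth
function `lam` with `-∇_T V = lam T` for every tangent vector `T`. -/
def IsTotallyUmbilical (G : Metric3) (ι : M → Space3) : Prop :=
  ∀ m₀ : M, ∃ W : Set M, IsOpen W ∧ m₀ ∈ W ∧ ∃ (V : M → Space3) (δ : ℝ) (lam : M → ℝ),
    IsUnitNormalOn G ι W V δ ∧ ContMDiffOn (𝓡 2) 𝓘(ℝ, ℝ) ∞ lam W ∧
    ∀ m ∈ W, ∀ T : TangentSpace (𝓡 2) m, -covDerivAlong G ι V m T = lam m • surfDeriv ι m T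

/-- `ι` is totally geodesic: near every point there is a unit normal field whose shape operator
vanishes, so that the second fundamental form is zero. -/
def IsTotallyGeodesic (G : Metric3) (ι : M → Space3) : Prop :=
  ∀ m₀ : M, ∃ W : Set M, IsOpen W ∧ m₀ ∈ W ∧ ∃ (V : M → Space3) (δ : ℝ),
    IsUnitNormalOn G ι W V δ ∧
    ∀ m ∈ W, ∀ T : TangentSpace (𝓡 2) m, -covDerivAlong G ι V m T = 0

/-- `ι` belongs to the family of parallel surfaces with constant `C`: near every point it
parametrises a piece `{(u, x(v), v)}`, `u` and `v` ranging over open intervals, where `x` is smooth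
and `x''(v) - (ε/2) f_x(x(v), v) = C`. -/
def IsParallelFamilySurface (ε : ℝ) (f : ℝ → ℝ → ℝ) (C : ℝ) (ι : M → Space3) : Prop :=
  ∀ m₀ : M, ∃ W : Set M, IsOpen W ∧ m₀ ∈ W ∧ ∃ (a b c d : ℝ) (x : ℝ → ℝ),
    ContDiffOn ℝ ∞ x (Set.Ioo c d) ∧
    (∀ v ∈ Set.Ioo c d,
      iteratedDeriv 2 x v - ε / 2 * deriv (fun s => f s v) (x v) = C) ∧
    Set.BijOn ι W {p : Space3 | p 0 ∈ Set.Ioo a b ∧ p 2 ∈ Set.Ioo c d ∧ p 1 = x (p 2)}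

/-- The points of the surface at which `∂_t` is not tangent to it. -/
def transversePoints (ι : M → Space3) : Set M :=
  {m | ∀ T : TangentSpace (𝓡 2) m, surfDeriv ι m T ≠ dt}

/-- The points of `N` with the same `(x, y)` as some point of the surface at which `∂_t` is not
tangent to it. -/
def transverseCylinder (N : Set Space3) (ι : M → Space3) : Set Space3 :=
  {p | p ∈ N ∧ ∃ m ∈ transversePoints ι, ι m 1 = p 1 ∧ ι m 2 = p 2}

end Surface

end

/-!
A conformal metric `e^{2φ} g` in dimension three is flat exactly when its Schouten tensor vanishes
(`riemann_conformalWalker`, `isFlatOn_conformalWalker_iff`). For the Walker metric `g` this is an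
overdetermined system that expresses all the second derivatives of `φ` through the first ones and
`f`. The compatibility condition `∂_y φ_{xy} = ∂_x φ_{yy}` of the system reduces to `f_{xxx} = 0`,
the vanishing of the Cotton tensor of `g`. Conversely, if `f_{xxx} = 0`, then `f_{xx}` is locally a
function of `y`, and a factor `φ = φ(y)` is obtained by solving the Riccati equation
`φ'' = (φ')² - (ε/2) f_{xx}`. This gives `isLocallyConformallyFlatOn_walkerMetric_iff`.

For a totally umbilical surface with unit normal `V` and umbilicity factor `λ` put
`h = ⟨V, ∂_t⟩`; the field `∂_t` is tangent to the surface exactly where `h = 0`. Since `∂_t` is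
parallel, `dh = -λ dy` along the surface, and the Codazzi equation gives
`dλ = -(ε/2) h f_{xx} dy` (`UmbilicPatch.fderiv_lam`). Two consequences carry the argument.
Applying `d` to the second equation yields `h f_{xxx} dx ∧ dy = 0`, so that `f_{xxx}` vanishes at
the points where `∂_t` is transverse (`UmbilicPatch.xDeriv_three_eq_zero`); there `(x, y)` are local
coordinates of the surface, so that the cylinder over these points is open. On the other hand the
two equations are a linear homogeneous system for `(h, λ)` along every curve, so that the vanishing
of `(h, λ)` at a point spreads to a neighbourhood (`UmbilicPatch.eventually_eq_zero`). On an open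
set where `h = 0`, also `λ = 0`; hence the interior of the set of non-transverse points is closed,
and by connectedness it is empty or the whole surface. In the first case the transverse points are
dense. In the second case `h` and `λ` vanish identically, the surface is totally geodesic and ruled
by the lines in the direction `∂_t`, and `∇V = 0` is the equation `x'' = (ε/2) f_x` for its profile
curve (`UmbilicPatch.exists_bijOn_graph`).
-/

/-! ### Calculus on open sets -/

section Calculus

variable {E : Type*} [NormedAddCommGroup E] [NormedSpace ℝ E]

theorem ContDiffOn.differentiableAt_of_isOpen {F : Type*} [NormedAddCommGroup F] [NormedSpace ℝ F]
    {D : Set E} (hD : IsOpen D) {u : E → F} (hu : ContDiffOn ℝ ∞ u D) {p : E} (hp : p ∈ D) :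
    DifferentiableAt ℝ u p :=
  (hu.contDiffAt (hD.mem_nhds hp)).differentiableAt (by simp)

theorem ContDiffOn.fderiv_apply_of_isOpen {F : Type*} [NormedAddCommGroup F] [NormedSpace ℝ F]
    {D : Set E} (hD : IsOpen D) {u : E → F} (hu : ContDiffOn ℝ ∞ u D) (a : E) :
    ContDiffOn ℝ ∞ (fun p => fderiv ℝ u p a) D :=
  (hu.fderiv_of_isOpen hD (by simp)).clm_apply contDiffOn_const

theorem fderiv_fderiv_comm_of_isOpen {D : Set E} (hD : IsOpen D) {u : E → ℝ}
    (hu : ContDiffOn ℝ ∞ u D) {p : E} (hp : p ∈ D) (a b : E) :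
    fderiv ℝ (fun q => fderiv ℝ u q b) p a = fderiv ℝ (fun q => fderiv ℝ u q a) p b := by
  have hc : ContDiffAt ℝ ∞ u p := hu.contDiffAt (hD.mem_nhds hp)
  have hd : DifferentiableAt ℝ (fderiv ℝ u) p :=
    (hu.fderiv_of_isOpen hD (m := ∞) (by simp)).differentiableAt_of_isOpen hD hp
  have hs : IsSymmSndFDerivAt ℝ u p := hc.isSymmSndFDerivAt (by
    simpa using WithTop.coe_le_coe.2 (le_top : (2 : ℕ∞) ≤ ⊤))
  rw [fderiv_clm_apply hd (by fun_prop), fderiv_clm_apply hd (by fun_prop)]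
  simpa using hs.eq a b

theorem fderiv_mul_apply {u v : E → ℝ} {p : E} (hu : DifferentiableAt ℝ u p)
    (hv : DifferentiableAt ℝ v p) (a : E) :
    fderiv ℝ (fun q => u q * v q) p a = u p * fderiv ℝ v p a + v p * fderiv ℝ u p a := by
  simp [fderiv_fun_mul hu hv]

/-- The identity `d(du) = 0` for a function whose differential is written as `∑ αᵢ dβᵢ`. -/
theorem sum_wedge_eq_zero_of_fderiv_eq {ι : Type*} [Fintype ι] {D : Set E} (hD : IsOpen D)
    {u : E → ℝ} {α β : ι → E → ℝ} (hu : ContDiffOn ℝ ∞ u D) (hα : ∀ i, ContDiffOn ℝ ∞ (α i) D)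
    (hβ : ∀ i, ContDiffOn ℝ ∞ (β i) D)
    (h : ∀ p ∈ D, ∀ b, fderiv ℝ u p b = ∑ i, α i p * fderiv ℝ (β i) p b)
    {p : E} (hp : p ∈ D) (a b : E) :
    ∑ i, (fderiv ℝ (α i) p a * fderiv ℝ (β i) p b
      - fderiv ℝ (α i) p b * fderiv ℝ (β i) p a) = 0 := by
  have key : ∀ c e : E, fderiv ℝ (fun q => fderiv ℝ u q e) p c =
      ∑ i, (α i p * fderiv ℝ (fun q => fderiv ℝ (β i) q e) p c
        + fderiv ℝ (β i) p e * fderiv ℝ (α i) p c) := by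
    intro c e
    have he : (fun q => fderiv ℝ u q e) =ᶠ[nhds p]
        fun q => ∑ i, α i q * fderiv ℝ (β i) q e := by
      filter_upwards [hD.mem_nhds hp] with q hq using h q hq e
    have hαd := fun i => (hα i).differentiableAt_of_isOpen hD hp
    have hβd := fun i => ((hβ i).fderiv_apply_of_isOpen hD e).differentiableAt_of_isOpen hD hp
    rw [he.fderiv_eq, fderiv_fun_sum (fun i _ => (hαd i).fun_mul (hβd i))]
    simp only [_root_.sum_apply]
    refine Finset.sum_congr rfl fun i _ => ?_
    rw [fderiv_fun_mul (hαd i) (hβd i)]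
    simp
  have h1 := fderiv_fderiv_comm_of_isOpen hD hu hp a b
  rw [key, key, ← sub_eq_zero, ← Finset.sum_sub_distrib] at h1
  rw [← h1]
  refine Finset.sum_congr rfl fun i _ => ?_
  rw [fderiv_fderiv_comm_of_isOpen hD (hβ i) hp a b]
  ring

end Calculus

/-! ### Derivatives of `f` as functions on the ambient space -/

section Ambient

variable {f : ℝ → ℝ → ℝ} {N : Set Space3}

theorem xDeriv_zero (f : ℝ → ℝ → ℝ) (p : Space3) : xDeriv 0 f p = f (p 1) (p 2) := by
  simp [xDeriv]

theorem xDeriv_one (f : ℝ → ℝ → ℝ) (p : Space3) :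
    xDeriv 1 f p = deriv (fun s => f s (p 2)) (p 1) := by
  simp [xDeriv]

theorem pderiv3_one_xDeriv {n : ℕ} {p : Space3} (h : DifferentiableAt ℝ (xDeriv n f) p) :
    pderiv3 1 (xDeriv n f) p = xDeriv (n + 1) f p := by
  have hc : HasDerivAt (fun s : ℝ => Function.update p 1 s) (Pi.single 1 1) (p 1) :=
    hasDerivAt_update p 1 (p 1)
  have h' : HasFDerivAt (xDeriv n f) (fderiv ℝ (xDeriv n f) p) (Function.update p 1 (p 1)) := by
    simpa using h.hasFDerivAt
  have h2 := (h'.comp_hasDerivAt (p 1) hc).deriv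
  rw [pderiv3, ← h2, xDeriv, iteratedDeriv_succ]
  congr 1

theorem pderiv3_zero_xDeriv {n : ℕ} {p : Space3} (h : DifferentiableAt ℝ (xDeriv n f) p) :
    pderiv3 0 (xDeriv n f) p = 0 := by
  have hc : HasDerivAt (fun s : ℝ => Function.update p 0 s) (Pi.single 0 1) (p 0) :=
    hasDerivAt_update p 0 (p 0)
  have h' : HasFDerivAt (xDeriv n f) (fderiv ℝ (xDeriv n f) p) (Function.update p 0 (p 0)) := by
    simpa using h.hasFDerivAt
  have h2 := (h'.comp_hasDerivAt (p 0) hc).deriv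
  rw [pderiv3, ← h2]
  have : (xDeriv n f ∘ fun s : ℝ => Function.update p 0 s) = fun _ => xDeriv n f p := by
    funext s
    simp [xDeriv]
  simp [this]

theorem contDiffOn_xDeriv (hN : IsOpen N)
    (hf : ContDiffOn ℝ ∞ (Function.uncurry f) (xyImage N)) (n : ℕ) :
    ContDiffOn ℝ ∞ (xDeriv n f) N := by
  induction n with
  | zero =>
    have h : xDeriv 0 f = Function.uncurry f ∘ fun p : Space3 => (p 1, p 2) := by
      funext p; simp [xDeriv_zero]
    rw [h]
    exact hf.comp (by fun_prop) fun p hp => ⟨p, hp, rfl⟩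
  | succ n ih =>
    exact (ih.fderiv_apply_of_isOpen hN (Pi.single 1 1)).congr fun p hp =>
      (pderiv3_one_xDeriv (ih.differentiableAt_of_isOpen hN hp)).symm

theorem analyticOnNhd_xDeriv
    (hf : AnalyticOnNhd ℝ (Function.uncurry f) (xyImage N)) (hN : IsOpen N) (n : ℕ) :
    AnalyticOnNhd ℝ (xDeriv n f) N := by
  induction n with
  | zero =>
    have h : xDeriv 0 f = Function.uncurry f ∘ fun p : Space3 => (p 1, p 2) := by
      funext p; simp [xDeriv_zero]
    rw [h]
    refine hf.comp ?_ fun p hp => ⟨p, hp, rfl⟩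
    let L : Space3 →L[ℝ] ℝ × ℝ :=
      (ContinuousLinearMap.proj 1).prod (ContinuousLinearMap.proj 2)
    exact L.analyticOnNhd N
  | succ n ih =>
    have h1 : AnalyticOnNhd ℝ (fun p => fderiv ℝ (xDeriv n f) p (Pi.single 1 1)) N := fun p hp =>
      ((ContinuousLinearMap.apply ℝ ℝ (Pi.single 1 1 : Space3)).analyticAt _).comp (ih.fderiv p hp)
    exact h1.congr hN fun p hp => pderiv3_one_xDeriv (ih p hp).differentiableAt

theorem fderiv_space3_apply (u : Space3 → ℝ) (p v : Space3) :
    fderiv ℝ u p v = v 0 * pderiv3 0 u p + v 1 * pderiv3 1 u p + v 2 * pderiv3 2 u p := by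
  have hv : v = v 0 • Pi.single 0 1 + v 1 • Pi.single 1 1 + v 2 • Pi.single 2 1 := by
    ext i; fin_cases i <;> simp
  conv_lhs => rw [hv]
  simp [pderiv3]

theorem fderiv_xDeriv_apply {n : ℕ} {p : Space3} (h : DifferentiableAt ℝ (xDeriv n f) p)
    (v : Space3) :
    fderiv ℝ (xDeriv n f) p v = v 1 * xDeriv (n + 1) f p + v 2 * pderiv3 2 (xDeriv n f) p := by
  rw [fderiv_space3_apply, pderiv3_zero_xDeriv h, pderiv3_one_xDeriv h]
  ring

end Ambient

section Rules

variable {u v : Space3 → ℝ} {p : Space3}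

theorem pderiv3_congr {i : Fin 3} (h : u =ᶠ[nhds p] v) : pderiv3 i u p = pderiv3 i v p := by
  rw [pderiv3, pderiv3, h.fderiv_eq]

theorem pderiv3_const (i : Fin 3) (c : ℝ) : pderiv3 i (fun _ => c) p = 0 := by
  simp [pderiv3]

theorem pderiv3_add (i : Fin 3) (hu : DifferentiableAt ℝ u p) (hv : DifferentiableAt ℝ v p) :
    pderiv3 i (fun q => u q + v q) p = pderiv3 i u p + pderiv3 i v p := by
  simp [pderiv3, fderiv_fun_add hu hv]

theorem pderiv3_sub (i : Fin 3) (hu : DifferentiableAt ℝ u p) (hv : DifferentiableAt ℝ v p) :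
    pderiv3 i (fun q => u q - v q) p = pderiv3 i u p - pderiv3 i v p := by
  simp [pderiv3, fderiv_fun_sub hu hv]

theorem pderiv3_neg (i : Fin 3) : pderiv3 i (fun q => -u q) p = -pderiv3 i u p := by
  simp [pderiv3, fderiv_fun_neg]

theorem pderiv3_mul (i : Fin 3) (hu : DifferentiableAt ℝ u p) (hv : DifferentiableAt ℝ v p) :
    pderiv3 i (fun q => u q * v q) p = u p * pderiv3 i v p + v p * pderiv3 i u p := by
  simp [pderiv3, fderiv_fun_mul hu hv]

theorem pderiv3_div_const (i : Fin 3) (hu : DifferentiableAt ℝ u p) (c : ℝ) :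
    pderiv3 i (fun q => u q / c) p = pderiv3 i u p / c := by
  simp only [div_eq_mul_inv, pderiv3_mul i hu (differentiableAt_const c⁻¹), pderiv3_const]
  ring

theorem ContDiffOn.pderiv3_of_isOpen {U : Set Space3} (hU : IsOpen U) (hu : ContDiffOn ℝ ∞ u U)
    (i : Fin 3) : ContDiffOn ℝ ∞ (pderiv3 i u) U :=
  hu.fderiv_apply_of_isOpen hU (Pi.single i 1)

theorem pderiv3_comm {U : Set Space3} (hU : IsOpen U) (hu : ContDiffOn ℝ ∞ u U) (hp : p ∈ U)
    (i j : Fin 3) : pderiv3 i (pderiv3 j u) p = pderiv3 j (pderiv3 i u) p :=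
  fderiv_fderiv_comm_of_isOpen hU hu hp _ _

end Rules

/-! ### Conformal changes of the Walker metric -/

/-- The metric `e^{2φ} g` conformal to the Walker metric `g`. -/
noncomputable def conformalWalker (ε : ℝ) (f : ℝ → ℝ → ℝ) (φ : Space3 → ℝ) : Metric3 :=
  fun q => Real.exp (2 * φ q) • walkerMetric ε f q

/-- The Christoffel symbols of `e^{2φ} g`, `g` the Walker metric; the outer index is the upper
one. The function `f` enters as `xDeriv 0 f`, its pull-back to the space. -/
noncomputable def conformalChristoffel (ε : ℝ) (f : ℝ → ℝ → ℝ) (φ : Space3 → ℝ)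
    (k i j : Fin 3) (p : Space3) : ℝ :=
  let F := xDeriv 0 f p
  let Fx := xDeriv 1 f p
  let Fy := pderiv3 2 (xDeriv 0 f) p
  let P := pderiv3 0 φ p
  let Q := pderiv3 1 φ p
  let R := pderiv3 2 φ p
  ![!![2 * P, Q, F * P;
       Q, -(ε * (R - F * P)), Fx / 2;
       F * P, Fx / 2, Fy / 2 - F * (R - F * P)],
    !![0, P, -(ε * Q);
       P, Q, R;
       -(ε * Q), R, -(ε * Fx / 2) - ε * F * Q],
    !![0, 0, 0;
       0, -(ε * P), Q;
       0, Q, 2 * R - F * P]] k i j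

theorem inv_exp_smul_walkerMetric {ε : ℝ} (hε : ε = 1 ∨ ε = -1) (f : ℝ → ℝ → ℝ) (c : ℝ)
    (p : Space3) :
    (Real.exp c • walkerMetric ε f p)⁻¹ =
      Real.exp (-c) • !![-xDeriv 0 f p, 0, 1; 0, ε, 0; 1, 0, 0] := by
  have h2 : ε * ε = 1 := by rcases hε with rfl | rfl <;> norm_num
  apply Matrix.inv_eq_right_inv
  rw [Matrix.smul_mul, Matrix.mul_smul, smul_smul, ← Real.exp_add]
  ext i j
  fin_cases i <;> fin_cases j <;>
    simp [walkerMetric, xDeriv_zero, h2]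

theorem pderiv3_walkerMetric (ε : ℝ) (f : ℝ → ℝ → ℝ) (i j l : Fin 3) (p : Space3) :
    pderiv3 i (fun q => walkerMetric ε f q j l) p =
      !![0, 0, 0; 0, 0, 0; 0, 0, pderiv3 i (xDeriv 0 f) p] j l := by
  have h : (fun q : Space3 => f (q 1) (q 2)) = xDeriv 0 f := by
    funext q; rw [xDeriv_zero]
  fin_cases j <;> fin_cases l <;> simp [walkerMetric, h] <;> simp [pderiv3]

theorem differentiableAt_walkerMetric (ε : ℝ) {f : ℝ → ℝ → ℝ} {p : Space3}
    (hf : DifferentiableAt ℝ (xDeriv 0 f) p) (j l : Fin 3) :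
    DifferentiableAt ℝ (fun q => walkerMetric ε f q j l) p := by
  have h : (fun q : Space3 => f (q 1) (q 2)) = xDeriv 0 f := by
    funext q; rw [xDeriv_zero]
  fin_cases j <;> fin_cases l <;> simp [walkerMetric, h, hf]

theorem pderiv3_conformalWalker (ε : ℝ) {f : ℝ → ℝ → ℝ} {φ : Space3 → ℝ} {p : Space3}
    (hf : DifferentiableAt ℝ (xDeriv 0 f) p) (hφ : DifferentiableAt ℝ φ p) (i j l : Fin 3) :
    pderiv3 i (fun q => conformalWalker ε f φ q j l) p = Real.exp (2 * φ p) *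
      (2 * pderiv3 i φ p * walkerMetric ε f p j l +
        pderiv3 i (fun q => walkerMetric ε f q j l) p) := by
  simp only [conformalWalker, Matrix.smul_apply, smul_eq_mul, pderiv3]
  have h1 : HasFDerivAt (fun q => Real.exp (2 * φ q)) _ p :=
    ((hφ.hasFDerivAt.const_mul 2).exp)
  rw [(h1.fun_mul (differentiableAt_walkerMetric ε hf j l).hasFDerivAt).fderiv]
  simp
  ring

theorem christoffel_conformalWalker {ε : ℝ} (hε : ε = 1 ∨ ε = -1) {f : ℝ → ℝ → ℝ}
    {φ : Space3 → ℝ} {p : Space3}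
    (hf : DifferentiableAt ℝ (xDeriv 0 f) p) (hφ : DifferentiableAt ℝ φ p) (k i j : Fin 3) :
    (conformalWalker ε f φ).christoffel k i j p = conformalChristoffel ε f φ k i j p := by
  have h2 : ε * ε = 1 := by rcases hε with rfl | rfl <;> norm_num
  have hexp : Real.exp (-(2 * φ p)) * Real.exp (2 * φ p) = 1 := by
    rw [← Real.exp_add]; simp
  have haux : ∀ a u v w : ℝ, Real.exp (-(2 * φ p)) * a * (Real.exp (2 * φ p) * u
      + Real.exp (2 * φ p) * v - Real.exp (2 * φ p) * w) = a * (u + v - w) := by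
    intro a u v w
    linear_combination (a * (u + v - w)) * hexp
  have hs : ∀ l, (conformalWalker ε f φ p)⁻¹ k l *
      (pderiv3 i (fun q => conformalWalker ε f φ q j l) p
        + pderiv3 j (fun q => conformalWalker ε f φ q i l) p
        - pderiv3 l (fun q => conformalWalker ε f φ q i j) p) =
      !![-xDeriv 0 f p, 0, 1; 0, ε, 0; 1, 0, 0] k l *
      ((2 * pderiv3 i φ p * walkerMetric ε f p j l +
          !![0, 0, 0; 0, 0, 0; 0, 0, pderiv3 i (xDeriv 0 f) p] j l)
        + (2 * pderiv3 j φ p * walkerMetric ε f p i l +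
          !![0, 0, 0; 0, 0, 0; 0, 0, pderiv3 j (xDeriv 0 f) p] i l)
        - (2 * pderiv3 l φ p * walkerMetric ε f p i j +
          !![0, 0, 0; 0, 0, 0; 0, 0, pderiv3 l (xDeriv 0 f) p] i j)) := by
    intro l
    rw [pderiv3_conformalWalker ε hf hφ, pderiv3_conformalWalker ε hf hφ,
      pderiv3_conformalWalker ε hf hφ, pderiv3_walkerMetric, pderiv3_walkerMetric,
      pderiv3_walkerMetric, conformalWalker, inv_exp_smul_walkerMetric hε,
      Matrix.smul_apply, smul_eq_mul]
    exact haux _ _ _ _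
  have hx := pderiv3_one_xDeriv hf
  have h0 := pderiv3_zero_xDeriv hf
  simp only [Metric3.christoffel, hs, Fin.sum_univ_three, conformalChristoffel]
  fin_cases k <;> fin_cases i <;> fin_cases j <;>
    simp [walkerMetric, hx, h0, ← xDeriv_zero] <;>
    first
      | ring1
      | linear_combination (pderiv3 0 φ p) * h2
      | linear_combination (pderiv3 1 φ p) * h2
      | linear_combination (pderiv3 2 φ p) * h2

/-- The tensor `T = P - ∇dφ + dφ ⊗ dφ - ½ |dφ|² g`, `P` the Schouten tensor of the Walker metric
`g`. It is the Schouten tensor of `e^{2φ} g`, so that in dimension three its vanishing is the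
flatness of `e^{2φ} g`. -/
noncomputable def conformalSchouten (ε : ℝ) (f : ℝ → ℝ → ℝ) (φ : Space3 → ℝ) (p : Space3) :
    Matrix (Fin 3) (Fin 3) ℝ :=
  let F := xDeriv 0 f p
  let Fx := xDeriv 1 f p
  let Fxx := xDeriv 2 f p
  let Fy := pderiv3 2 (xDeriv 0 f) p
  let P := pderiv3 0 φ p
  let Q := pderiv3 1 φ p
  let R := pderiv3 2 φ p
  let S := (-(F * P ^ 2) + 2 * P * R + ε * Q ^ 2) / 2
  let H := fun i j : Fin 3 => pderiv3 i (pderiv3 j φ) p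
  !![P ^ 2 - H 0 0, P * Q - H 0 1, P * R - S - H 0 2;
     P * Q - H 0 1, Q ^ 2 - ε * S - H 1 1, Fx / 2 * P + Q * R - H 1 2;
     P * R - S - H 0 2, Fx / 2 * P + Q * R - H 1 2,
      Fy / 2 * P - ε * Fx / 2 * Q + R ^ 2 - F * S - ε / 2 * Fxx - H 2 2]

set_option maxHeartbeats 2000000 in
/-- In dimension three the curvature tensor is the Kulkarni–Nomizu product of the metric and the
Schouten tensor; the conformal factors cancel when the first index is raised. -/
theorem riemann_conformalWalker {ε : ℝ} (hε : ε = 1 ∨ ε = -1) {f : ℝ → ℝ → ℝ} {φ : Space3 → ℝ}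
    {U : Set Space3} (hU : IsOpen U) (hf : ContDiffOn ℝ ∞ (xDeriv 0 f) U)
    (hφ : ContDiffOn ℝ ∞ φ U) {p : Space3} (hp : p ∈ U) {i j : Fin 3} (hij : i < j) (l k : Fin 3) :
    (conformalWalker ε f φ).riemann l k i j p =
      let T := conformalSchouten ε f φ p
      let I := !![-xDeriv 0 f p, 0, 1; 0, ε, 0; 1, 0, 0]
      (if l = i then T j k else 0) - (if l = j then T i k else 0)
        + walkerMetric ε f p j k * (I * T) l i - walkerMetric ε f p i k * (I * T) l j := by
  have hΓ : ∀ q ∈ U, ∀ k i j,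
      (conformalWalker ε f φ).christoffel k i j q = conformalChristoffel ε f φ k i j q :=
    fun q hq => christoffel_conformalWalker hε (hf.differentiableAt_of_isOpen hU hq)
      (hφ.differentiableAt_of_isOpen hU hq)
  have hdΓ : ∀ m k i j, pderiv3 m ((conformalWalker ε f φ).christoffel k i j) p =
      pderiv3 m (fun q => conformalChristoffel ε f φ k i j q) p := fun m k i j =>
    pderiv3_congr (by filter_upwards [hU.mem_nhds hp] with q hq using hΓ q hq k i j)
  simp only [Metric3.riemann, hΓ p hp, hdΓ, Fin.sum_univ_three]
  have d0 := hf.differentiableAt_of_isOpen hU hp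
  have x0 := pderiv3_one_xDeriv d0
  have z0 := pderiv3_zero_xDeriv d0
  have hf1 : ContDiffOn ℝ ∞ (xDeriv 1 f) U := (hf.pderiv3_of_isOpen hU 1).congr fun q hq =>
    (pderiv3_one_xDeriv (hf.differentiableAt_of_isOpen hU hq)).symm
  have d1 := hf1.differentiableAt_of_isOpen hU hp
  have x1 := pderiv3_one_xDeriv d1
  have z1 := pderiv3_zero_xDeriv d1
  have dy := (hf.pderiv3_of_isOpen hU 2).differentiableAt_of_isOpen hU hp
  have xy : pderiv3 1 (pderiv3 2 (xDeriv 0 f)) p = pderiv3 2 (xDeriv 1 f) p := by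
    rw [pderiv3_comm hU hf hp]
    refine pderiv3_congr ?_
    filter_upwards [hU.mem_nhds hp] with q hq
      using pderiv3_one_xDeriv (hf.differentiableAt_of_isOpen hU hq)
  have zy : pderiv3 0 (pderiv3 2 (xDeriv 0 f)) p = 0 := by
    rw [pderiv3_comm hU hf hp, ← pderiv3_const 2 0]
    refine pderiv3_congr ?_
    filter_upwards [hU.mem_nhds hp] with q hq
      using pderiv3_zero_xDeriv (hf.differentiableAt_of_isOpen hU hq)
  have e0 := (hφ.pderiv3_of_isOpen hU 0).differentiableAt_of_isOpen hU hp
  have e1 := (hφ.pderiv3_of_isOpen hU 1).differentiableAt_of_isOpen hU hp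
  have e2 := (hφ.pderiv3_of_isOpen hU 2).differentiableAt_of_isOpen hU hp
  have c10 := pderiv3_comm hU hφ hp 1 0
  have c20 := pderiv3_comm hU hφ hp 2 0
  have c21 := pderiv3_comm hU hφ hp 2 1
  have hcase : (i = 0 ∧ j = 1) ∨ (i = 0 ∧ j = 2) ∨ (i = 1 ∧ j = 2) := by
    fin_cases i <;> fin_cases j <;> simp_all
  rcases hcase with ⟨rfl, rfl⟩ | ⟨rfl, rfl⟩ | ⟨rfl, rfl⟩ <;> fin_cases l <;> fin_cases k <;>
    simp (disch := fun_prop) [conformalChristoffel, conformalSchouten, walkerMetric,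
      ← xDeriv_zero, Matrix.mul_apply, Fin.sum_univ_three, pderiv3_const,
      pderiv3_sub, pderiv3_neg, pderiv3_mul, pderiv3_div_const, x0, z0, x1, z1, xy, zy,
      c10, c20, c21] <;>
    rcases hε with rfl | rfl <;> ring1

/-! ### Local conformal flatness -/

theorem riemann_swap (G : Metric3) (l k i j : Fin 3) (p : Space3) :
    G.riemann l k i j p = -G.riemann l k j i p := by
  simp only [Metric3.riemann, Fin.sum_univ_three]
  ring

/-- Flatness of `e^{2φ} g` is the system of equations `T = 0`. -/
theorem isFlatOn_conformalWalker_iff {ε : ℝ} (hε : ε = 1 ∨ ε = -1) {f : ℝ → ℝ → ℝ}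
    {φ : Space3 → ℝ} {U : Set Space3} (hU : IsOpen U) (hf : ContDiffOn ℝ ∞ (xDeriv 0 f) U)
    (hφ : ContDiffOn ℝ ∞ φ U) :
    (conformalWalker ε f φ).IsFlatOn U ↔ ∀ p ∈ U, conformalSchouten ε f φ p = 0 := by
  constructor
  · intro h p hp
    have hR := fun i j (hij : i < j) l k =>
      (riemann_conformalWalker hε hU hf hφ hp hij l k).symm.trans (h p hp l k i j)
    have r1 := hR 0 1 (by decide) 2 1
    have r2 := hR 0 1 (by decide) 2 2
    have r3 := hR 0 2 (by decide) 2 2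
    have r4 := hR 1 2 (by decide) 2 1
    have r5 := hR 1 2 (by decide) 2 2
    have r6 := hR 1 2 (by decide) 1 2
    have s10 : conformalSchouten ε f φ p 1 0 = conformalSchouten ε f φ p 0 1 := rfl
    have s20 : conformalSchouten ε f φ p 2 0 = conformalSchouten ε f φ p 0 2 := rfl
    have s21 : conformalSchouten ε f φ p 2 1 = conformalSchouten ε f φ p 1 2 := rfl
    generalize conformalSchouten ε f φ p = T at r1 r2 r3 r4 r5 r6 s10 s20 s21 ⊢
    have hε0 : ε ≠ 0 := by rcases hε with rfl | rfl <;> norm_num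
    simp [walkerMetric, Matrix.mul_apply, Fin.sum_univ_three, hε0] at r1 r2 r3 r4 r5 r6
    have t01 : T 0 1 = 0 := by linarith
    have t02 : T 0 2 = 0 := by
      simp only [r1, mul_zero] at r3
      linarith
    have t11 : T 1 1 = 0 := by
      simp only [t02, mul_zero] at r4
      linarith
    have t12 : T 1 2 = 0 := by
      simp only [t01, mul_zero] at r5
      linarith
    have t22 : T 2 2 = 0 := by
      simp only [t11, mul_zero] at r6
      linarith
    ext i j
    fin_cases i <;> fin_cases j <;> simp [r1, s10, s20, s21, t01, t02, t11, t12, t22]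
  · intro h p hp l k
    have hlt : ∀ i j : Fin 3, i < j → (conformalWalker ε f φ).riemann l k i j p = 0 := by
      intro i j hij
      rw [riemann_conformalWalker hε hU hf hφ hp hij, h p hp]
      simp
    intro i j
    rcases lt_trichotomy i j with hij | rfl | hij
    · exact hlt i j hij
    · have := riemann_swap (conformalWalker ε f φ) l k i i p
      linarith
    · rw [riemann_swap, hlt j i hij, neg_zero]

/-- Local smooth solvability of `φ'' = (φ')² - q`; the function `ψ` is `φ'`. -/
theorem exists_contDiffOn_riccati {q : ℝ → ℝ} {J : Set ℝ} (hJ : IsOpen J)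
    (hq : ContDiffOn ℝ ∞ q J) {y₀ : ℝ} (hy₀ : y₀ ∈ J) :
    ∃ (I : Set ℝ) (φ ψ : ℝ → ℝ), IsOpen I ∧ y₀ ∈ I ∧ ContDiffOn ℝ ∞ φ I ∧
      ∀ y ∈ I, HasDerivAt φ (ψ y) y ∧ HasDerivAt ψ (ψ y ^ 2 - q y) y := by
  -- The autonomous system for `(y, φ, ψ)`.
  let v : ℝ × ℝ × ℝ → ℝ × ℝ × ℝ := fun z => (1, z.2.2, z.2.2 ^ 2 - q z.1)
  have hv : ContDiffAt ℝ 1 v (y₀, 0, 0) := by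
    have hq1 : ContDiffAt ℝ 1 q y₀ := (hq.contDiffAt (hJ.mem_nhds hy₀)).of_le (by simp)
    have hq2 : ContDiffAt ℝ 1 (fun z : ℝ × ℝ × ℝ => q z.1) (y₀, 0, 0) :=
      ContDiffAt.comp (g := q) (f := Prod.fst) (y₀, (0 : ℝ), (0 : ℝ)) hq1 contDiffAt_fst
    fun_prop
  obtain ⟨α, hα0, e, he, hα⟩ :=
    hv.exists_forall_mem_closedBall_exists_eq_forall_mem_Ioo_hasDerivAt₀ y₀
  have hy₀e : y₀ ∈ Set.Ioo (y₀ - e) (y₀ + e) := ⟨by linarith, by linarith⟩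
  have h1 : ∀ y ∈ Set.Ioo (y₀ - e) (y₀ + e), HasDerivAt (fun t => (α t).1) 1 y := fun y hy =>
    (hα y hy).fst
  have h2 : ∀ y ∈ Set.Ioo (y₀ - e) (y₀ + e), HasDerivAt (fun t => (α t).2.1) (α y).2.2 y :=
    fun y hy => (hα y hy).snd.fst
  have h3 : ∀ y ∈ Set.Ioo (y₀ - e) (y₀ + e),
      HasDerivAt (fun t => (α t).2.2) ((α y).2.2 ^ 2 - q (α y).1) y :=
    fun y hy => (hα y hy).snd.snd
  have hid : ∀ y ∈ Set.Ioo (y₀ - e) (y₀ + e), (α y).1 = y := by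
    intro y hy
    have hd : ∀ t ∈ Set.Ioo (y₀ - e) (y₀ + e), HasDerivAt (fun t => (α t).1 - t) 0 t := by
      intro t ht
      simpa using (h1 t ht).fun_sub (hasDerivAt_id' t)
    have := isOpen_Ioo.is_const_of_deriv_eq_zero isPreconnected_Ioo
      (fun t ht => (hd t ht).differentiableAt.differentiableWithinAt)
      (fun t ht => (hd t ht).deriv) hy hy₀e
    simp [hα0] at this
    linarith
  have hI : IsOpen (Set.Ioo (y₀ - e) (y₀ + e) ∩ J) := isOpen_Ioo.inter hJ
  have hψ : ∀ n : ℕ, ContDiffOn ℝ n (fun t => (α t).2.2) (Set.Ioo (y₀ - e) (y₀ + e) ∩ J) := by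
    intro n
    induction n with
    | zero =>
      exact contDiffOn_zero.2 fun y hy => (h3 y hy.1).continuousAt.continuousWithinAt
    | succ n ih =>
      push_cast
      rw [contDiffOn_succ_iff_deriv_of_isOpen hI]
      refine ⟨fun y hy => (h3 y hy.1).differentiableAt.differentiableWithinAt, by simp, ?_⟩
      refine ((ih.pow 2).sub ((hq.of_le ?_).mono Set.inter_subset_right)).congr fun y hy => ?_
      · exact_mod_cast le_top
      · rw [(h3 y hy.1).deriv, hid y hy.1]
  refine ⟨Set.Ioo (y₀ - e) (y₀ + e) ∩ J, fun t => (α t).2.1, fun t => (α t).2.2, hI,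
    ⟨hy₀e, hy₀⟩, ?_, fun y hy => ⟨h2 y hy.1, ?_⟩⟩
  · rw [contDiffOn_infty_iff_deriv_of_isOpen hI]
    exact ⟨fun y hy => (h2 y hy.1).differentiableAt.differentiableWithinAt,
      (contDiffOn_infty.2 hψ).congr fun y hy => (h2 y hy.1).deriv⟩
  · have := h3 y hy.1
    rwa [hid y hy.1] at this

theorem pderiv3_comp_two {g : ℝ → ℝ} {g' : ℝ} {p : Space3} (h : HasDerivAt g g' (p 2))
    (i : Fin 3) : pderiv3 i (fun q => g (q 2)) p = if i = 2 then g' else 0 := by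
  have h1 : HasFDerivAt (fun q : Space3 => q 2) (ContinuousLinearMap.proj (R := ℝ) 2) p :=
    hasFDerivAt_apply 2 p
  have h2 : HasFDerivAt (fun q : Space3 => g (q 2)) _ p := h.comp_hasFDerivAt p h1
  rw [pderiv3, h2.fderiv]
  fin_cases i <;> simp

/-- The equations `T = 0` express the second derivatives of `φ` through the first ones. Inserting
them into `∂_y φ_{xy} = ∂_x φ_{yy}` leaves only the component `f_{xxx}` of the Cotton tensor. -/
theorem xDeriv_three_eq_zero_of_conformalSchouten {ε : ℝ} (hε : ε = 1 ∨ ε = -1)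
    {f : ℝ → ℝ → ℝ} {φ : Space3 → ℝ} {U : Set Space3} (hU : IsOpen U)
    (hf : ∀ n, ContDiffOn ℝ ∞ (xDeriv n f) U) (hφ : ContDiffOn ℝ ∞ φ U)
    (hT : ∀ p ∈ U, conformalSchouten ε f φ p = 0) {p : Space3} (hp : p ∈ U) :
    xDeriv 3 f p = 0 := by
  have hT' : ∀ q ∈ U, ∀ i j, conformalSchouten ε f φ q i j = 0 := by
    intro q hq i j; rw [hT q hq]; rfl
  have t02 := fun q hq => hT' q hq 0 2
  have t11 := fun q hq => hT' q hq 1 1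
  have t12 := fun q hq => hT' q hq 1 2
  have t22 := fun q hq => hT' q hq 2 2
  have t01 := fun q hq => hT' q hq 0 1
  have d := fun n => (hf n).differentiableAt_of_isOpen hU hp
  have dy := ((hf 0).pderiv3_of_isOpen hU 2).differentiableAt_of_isOpen hU hp
  have e := fun i => (hφ.pderiv3_of_isOpen hU i).differentiableAt_of_isOpen hU hp
  have e0 := e 0
  have e1 := e 1
  have e2 := e 2
  have d0 := d 0
  have d1 := d 1
  have d2 := d 2
  simp [conformalSchouten, sub_eq_zero] at t01 t02 t11 t12 t22
  have k12 : pderiv3 2 (pderiv3 1 (pderiv3 2 φ)) p = _ :=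
    pderiv3_congr (by filter_upwards [hU.mem_nhds hp] with q hq using (t12 q hq).symm)
  have k22 : pderiv3 1 (pderiv3 2 (pderiv3 2 φ)) p = _ :=
    pderiv3_congr (by filter_upwards [hU.mem_nhds hp] with q hq using (t22 q hq).symm)
  rw [pderiv3_comm hU (hφ.pderiv3_of_isOpen hU 2) hp, k12] at k22
  have xy : pderiv3 1 (pderiv3 2 (xDeriv 0 f)) p = pderiv3 2 (xDeriv 1 f) p := by
    rw [pderiv3_comm hU (hf 0) hp]
    refine pderiv3_congr ?_
    filter_upwards [hU.mem_nhds hp] with q hq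
      using pderiv3_one_xDeriv ((hf 0).differentiableAt_of_isOpen hU hq)
  have c10 := pderiv3_comm hU hφ hp 1 0
  have c20 := pderiv3_comm hU hφ hp 2 0
  have c21 := pderiv3_comm hU hφ hp 2 1
  simp (disch := fun_prop) [pderiv3_const, pderiv3_add, pow_two,
      pderiv3_sub, pderiv3_neg, pderiv3_mul, pderiv3_div_const, pderiv3_one_xDeriv, xy,
      c10, c20, c21, ← t01 p hp, ← t02 p hp, ← t11 p hp, ← t12 p hp, ← t22 p hp] at k22
  rcases hε with rfl | rfl
  · linear_combination 2 * k22
  · linear_combination -2 * k22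

/-- If `f_{xxx}` vanishes on a ball, a cube as `Space3` carries the supremum norm, then `f_{xx}`
depends on `y` alone there. -/
theorem xDeriv_two_eq_of_xDeriv_three_eq_zero {f : ℝ → ℝ → ℝ} {p : Space3} {r : ℝ}
    (hf : ∀ q ∈ Metric.ball p r, DifferentiableAt ℝ (xDeriv 2 f) q)
    (h3 : ∀ q ∈ Metric.ball p r, xDeriv 3 f q = 0) {q : Space3} (hq : q ∈ Metric.ball p r) :
    xDeriv 2 f q = xDeriv 2 f (Function.update p 2 (q 2)) := by
  have hr : 0 < r := Metric.pos_of_mem_ball hq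
  have hmem : ∀ s ∈ Metric.ball (p 1) r, Function.update q 1 s ∈ Metric.ball p r := by
    intro s hs
    rw [Metric.mem_ball, dist_pi_lt_iff hr] at hq ⊢
    intro i
    by_cases hi : i = 1
    · subst hi; simpa using hs
    · simpa [hi] using hq i
  have hd : ∀ s ∈ Metric.ball (p 1) r,
      HasDerivAt (fun s => xDeriv 2 f (Function.update q 1 s)) 0 s := by
    intro s hs
    have hc : HasDerivAt (fun s : ℝ => Function.update q 1 s) (Pi.single 1 1) s :=
      hasDerivAt_update q 1 s
    have h := (hf _ (hmem s hs)).hasFDerivAt.comp_hasDerivAt s hc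
    have h' : fderiv ℝ (xDeriv 2 f) (Function.update q 1 s) (Pi.single 1 1) = 0 :=
      (pderiv3_one_xDeriv (hf _ (hmem s hs))).trans (h3 _ (hmem s hs))
    rwa [h'] at h
  have hq1 : q 1 ∈ Metric.ball (p 1) r := by
    rw [Metric.mem_ball, dist_pi_lt_iff hr] at hq
    exact hq 1
  have hconst := Metric.isOpen_ball.is_const_of_deriv_eq_zero
    (convex_ball (p 1) r).isPreconnected
    (fun s hs => (hd s hs).differentiableAt.differentiableWithinAt)
    (fun s hs => (hd s hs).deriv) hq1 (Metric.mem_ball_self hr)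
  simpa [xDeriv] using hconst

/-- The Walker metric is locally conformally flat exactly where `f` is quadratic in `x`. -/
theorem isLocallyConformallyFlatOn_walkerMetric_iff {ε : ℝ} (hε : ε = 1 ∨ ε = -1)
    {f : ℝ → ℝ → ℝ} {U : Set Space3} (hU : IsOpen U) (hf : ∀ n, ContDiffOn ℝ ∞ (xDeriv n f) U) :
    (walkerMetric ε f).IsLocallyConformallyFlatOn U ↔ ∀ p ∈ U, xDeriv 3 f p = 0 := by
  constructor
  · intro h p hp
    obtain ⟨W, hWU, hW, hpW, φ, hφ, hflat⟩ := h p hp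
    have hfW := fun n => (hf n).mono hWU
    exact xDeriv_three_eq_zero_of_conformalSchouten hε hW hfW hφ
      ((isFlatOn_conformalWalker_iff hε hW (hfW 0) hφ).1 hflat) hpW
  · intro h p hp
    obtain ⟨r, hr, hball⟩ := Metric.isOpen_iff.1 hU p hp
    let c : ℝ → Space3 := fun y => Function.update p 2 y
    have hc : ContDiff ℝ ∞ c := by
      rw [contDiff_pi]
      intro i
      by_cases hi : i = 2
      · subst hi; simpa [c] using contDiff_fun_id
      · simpa [c, hi] using contDiff_const
    have hJ : IsOpen (c ⁻¹' U) := hU.preimage hc.continuous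
    have hq : ContDiffOn ℝ ∞ (fun y => ε / 2 * xDeriv 2 f (c y)) (c ⁻¹' U) :=
      contDiffOn_const.mul ((hf 2).comp hc.contDiffOn fun y hy => hy)
    obtain ⟨I, φ, ψ, hI, hpI, hφ, hode⟩ :=
      exists_contDiffOn_riccati hJ hq (y₀ := p 2) (by simpa [c] using hp)
    have hW : IsOpen (Metric.ball p r ∩ {q : Space3 | q 2 ∈ I}) :=
      Metric.isOpen_ball.inter (hI.preimage (continuous_apply 2))
    have hφW : ContDiffOn ℝ ∞ (fun q : Space3 => φ (q 2))
        (Metric.ball p r ∩ {q : Space3 | q 2 ∈ I}) :=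
      hφ.comp (by fun_prop) fun q hq => hq.2
    refine ⟨Metric.ball p r ∩ {q : Space3 | q 2 ∈ I}, Set.inter_subset_left.trans hball, hW,
      ⟨Metric.mem_ball_self hr, hpI⟩, fun q => φ (q 2), hφW, ?_⟩
    refine (isFlatOn_conformalWalker_iff hε hW
      ((hf 0).mono (Set.inter_subset_left.trans hball)) hφW).2 fun q hq => ?_
    have h1 : ∀ z ∈ Metric.ball p r ∩ {q : Space3 | q 2 ∈ I}, ∀ i,
        pderiv3 i (fun q => φ (q 2)) z = if i = 2 then ψ (z 2) else 0 := fun z hz =>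
      pderiv3_comp_two (hode (z 2) hz.2).1
    have h2 : ∀ i j, pderiv3 i (pderiv3 j (fun q => φ (q 2))) q =
        if i = 2 ∧ j = 2 then ψ (q 2) ^ 2 - ε / 2 * xDeriv 2 f q else 0 := by
      intro i j
      have he : pderiv3 j (fun q => φ (q 2)) =ᶠ[nhds q]
          fun z => if j = 2 then ψ (z 2) else 0 := by
        filter_upwards [hW.mem_nhds hq] with z hz using h1 z hz j
      rw [pderiv3_congr he]
      by_cases hj : j = 2
      · simp only [hj, if_true, and_true]
        rw [pderiv3_comp_two (hode (q 2) hq.2).2, xDeriv_two_eq_of_xDeriv_three_eq_zero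
          (fun z hz => (hf 2).differentiableAt_of_isOpen hU (hball hz))
          (fun z hz => h z (hball hz)) hq.1]
      · simp [hj, pderiv3_const]
    ext i j
    fin_cases i <;> fin_cases j <;> simp [conformalSchouten, h1 q hq, h2]

/-! ### Parametrised umbilical surfaces -/

theorem walkerMetric_pair (ε : ℝ) (f : ℝ → ℝ → ℝ) (p u v : Space3) :
    (walkerMetric ε f).pair p u v =
      u 0 * v 2 + ε * u 1 * v 1 + u 2 * v 0 + xDeriv 0 f p * u 2 * v 2 := by
  simp [Metric3.pair, walkerMetric, Fin.sum_univ_three, xDeriv_zero]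
  ring

theorem christoffel_walkerMetric {ε : ℝ} (hε : ε = 1 ∨ ε = -1) {f : ℝ → ℝ → ℝ} {p : Space3}
    (hf : DifferentiableAt ℝ (xDeriv 0 f) p) (k i j : Fin 3) :
    (walkerMetric ε f).christoffel k i j p =
      ![!![0, 0, 0; 0, 0, xDeriv 1 f p / 2; 0, xDeriv 1 f p / 2, pderiv3 2 (xDeriv 0 f) p / 2],
        !![0, 0, 0; 0, 0, 0; 0, 0, -(ε * xDeriv 1 f p / 2)],
        !![0, 0, 0; 0, 0, 0; 0, 0, 0]] k i j := by
  have h : walkerMetric ε f = conformalWalker ε f (fun _ => 0) := by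
    funext q; simp [conformalWalker]
  rw [h, christoffel_conformalWalker hε hf (differentiableAt_const 0)]
  simp [conformalChristoffel, pderiv3_const]

/-- A parametrised totally umbilical surface `r : D → N` with unit normal `V` and umbilicity
factor `lam`, over an open subset `D` of `E`. That `E` is two-dimensional is a separate hypothesis
of the results that need it. -/
structure UmbilicPatch {E : Type*} [NormedAddCommGroup E] [NormedSpace ℝ E] (ε : ℝ)
    (f : ℝ → ℝ → ℝ) (N : Set Space3) (D : Set E) (r V : E → Space3) (δ : ℝ) (lam : E → ℝ) :
    Prop where
  isOpen : IsOpen D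
  smooth : ContDiffOn ℝ ∞ r D
  mem : ∀ p ∈ D, r p ∈ N
  nondegenerate : ∀ p ∈ D, ∀ a,
    (∀ b, (walkerMetric ε f).pair (r p) (fderiv ℝ r p a) (fderiv ℝ r p b) = 0) → a = 0
  smooth_normal : ContDiffOn ℝ ∞ V D
  sign : δ = 1 ∨ δ = -1
  normal : ∀ p ∈ D, ∀ a, (walkerMetric ε f).pair (r p) (fderiv ℝ r p a) (V p) = 0
  unit : ∀ p ∈ D, (walkerMetric ε f).pair (r p) (V p) (V p) = δ
  smooth_lam : ContDiffOn ℝ ∞ lam D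
  umbilic : ∀ p ∈ D, ∀ a k, -(fderiv ℝ V p a k + ∑ i, ∑ j,
    (walkerMetric ε f).christoffel k i j (r p) * fderiv ℝ r p a i * V p j) =
      lam p * fderiv ℝ r p a k

namespace UmbilicPatch

variable {E : Type*} [NormedAddCommGroup E] [NormedSpace ℝ E] {ε : ℝ} {f : ℝ → ℝ → ℝ}
  {N : Set Space3} {D : Set E} {r V : E → Space3} {δ : ℝ} {lam : E → ℝ}

theorem contDiffOn_coord (h : UmbilicPatch ε f N D r V δ lam) (i : Fin 3) :
    ContDiffOn ℝ ∞ (fun p => r p i) D :=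
  contDiffOn_pi.1 h.smooth i

theorem contDiffOn_normal (h : UmbilicPatch ε f N D r V δ lam) (i : Fin 3) :
    ContDiffOn ℝ ∞ (fun p => V p i) D :=
  contDiffOn_pi.1 h.smooth_normal i

theorem fderiv_coord (h : UmbilicPatch ε f N D r V δ lam) {p : E} (hp : p ∈ D) (a : E)
    (i : Fin 3) : fderiv ℝ r p a i = fderiv ℝ (fun q => r q i) p a := by
  rw [fderiv_pi fun j => (h.contDiffOn_coord j).differentiableAt_of_isOpen h.isOpen hp]
  rfl

theorem fderiv_normal_coord (h : UmbilicPatch ε f N D r V δ lam) {p : E} (hp : p ∈ D) (a : E)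
    (i : Fin 3) : fderiv ℝ V p a i = fderiv ℝ (fun q => V q i) p a := by
  rw [fderiv_pi fun j => (h.contDiffOn_normal j).differentiableAt_of_isOpen h.isOpen hp]
  rfl

theorem fderiv_xDeriv_comp (h : UmbilicPatch ε f N D r V δ lam) (hN : IsOpen N)
    (hf : ∀ n, ContDiffOn ℝ ∞ (xDeriv n f) N) (n : ℕ) {p : E} (hp : p ∈ D) (a : E) :
    fderiv ℝ (fun q => xDeriv n f (r q)) p a =
      fderiv ℝ (fun q => r q 1) p a * xDeriv (n + 1) f (r p)
        + fderiv ℝ (fun q => r q 2) p a * pderiv3 2 (xDeriv n f) (r p) := by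
  have hd := (hf n).differentiableAt_of_isOpen hN (h.mem p hp)
  have hr := h.smooth.differentiableAt_of_isOpen h.isOpen hp
  have hcomp := fderiv_comp p hd hr
  rw [show (fun q => xDeriv n f (r q)) = xDeriv n f ∘ r from rfl, hcomp,
    ContinuousLinearMap.comp_apply, fderiv_xDeriv_apply hd, h.fderiv_coord hp, h.fderiv_coord hp]

theorem normal_eq (h : UmbilicPatch ε f N D r V δ lam) {p : E} (hp : p ∈ D) (a : E) :
    fderiv ℝ (fun q => r q 0) p a * V p 2 + ε * fderiv ℝ (fun q => r q 1) p a * V p 1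
      + fderiv ℝ (fun q => r q 2) p a * V p 0
      + xDeriv 0 f (r p) * fderiv ℝ (fun q => r q 2) p a * V p 2 = 0 := by
  have := h.normal p hp a
  rwa [walkerMetric_pair, h.fderiv_coord hp, h.fderiv_coord hp, h.fderiv_coord hp] at this

theorem normal_one_ne_zero (h : UmbilicPatch ε f N D r V δ lam) {p : E} (hp : p ∈ D)
    (h0 : V p 2 = 0) : V p 1 ≠ 0 := by
  intro h1
  have h2 := h.unit p hp
  rw [walkerMetric_pair, h0, h1] at h2
  rcases h.sign with h3 | h3 <;> rw [h3] at h2 <;> norm_num at h2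

theorem eq_zero_of_fderiv_coord (h : UmbilicPatch ε f N D r V δ lam) {p : E} (hp : p ∈ D) {a : E}
    (ha : ∀ i, fderiv ℝ (fun q => r q i) p a = 0) : a = 0 := by
  refine h.nondegenerate p hp a fun b => ?_
  have hz : fderiv ℝ r p a = 0 := by
    ext i; rw [h.fderiv_coord hp, ha i]; rfl
  simp [hz, walkerMetric_pair]

/-- Where `∂_t` is transverse, `(x, y)` are local coordinates of the surface. -/
theorem surjective_xy (h : UmbilicPatch ε f N D r V δ lam) (hE : Module.finrank ℝ E = 2)
    {p : E} (hp : p ∈ D) (h0 : V p 2 ≠ 0) :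
    Function.Surjective ((fderiv ℝ (fun q => r q 1) p).prod (fderiv ℝ (fun q => r q 2) p)) := by
  have : FiniteDimensional ℝ E := FiniteDimensional.of_finrank_pos (by omega)
  have hinj : Function.Injective
      ((fderiv ℝ (fun q => r q 1) p).prod (fderiv ℝ (fun q => r q 2) p)).toLinearMap := by
    rw [injective_iff_map_eq_zero]
    intro a ha
    have h1 : fderiv ℝ (fun q => r q 1) p a = 0 := congrArg Prod.fst ha
    have h2 : fderiv ℝ (fun q => r q 2) p a = 0 := congrArg Prod.snd ha
    have h3 := h.normal_eq hp a
    rw [h1, h2] at h3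
    have h4 : fderiv ℝ (fun q => r q 0) p a = 0 := by
      simpa [h0] using h3
    refine h.eq_zero_of_fderiv_coord hp fun i => ?_
    fin_cases i
    exacts [h4, h1, h2]
  exact (LinearMap.injective_iff_surjective_of_finrank_eq_finrank (by simp [hE])).1 hinj

/-- Where `∂_t` is tangent, `(t, y)` are local coordinates of the surface. -/
theorem injective_ty (h : UmbilicPatch ε f N D r V δ lam) (hε : ε = 1 ∨ ε = -1)
    {p : E} (hp : p ∈ D) (h0 : V p 2 = 0) :
    Function.Injective ((fderiv ℝ (fun q => r q 0) p).prod (fderiv ℝ (fun q => r q 2) p)) := by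
  rw [injective_iff_map_eq_zero]
  intro a ha
  have h1 : fderiv ℝ (fun q => r q 0) p a = 0 := congrArg Prod.fst ha
  have h2 : fderiv ℝ (fun q => r q 2) p a = 0 := congrArg Prod.snd ha
  have h3 := h.normal_eq hp a
  rw [h1, h2, h0] at h3
  have hε0 : ε ≠ 0 := by rcases hε with rfl | rfl <;> norm_num
  have h4 : fderiv ℝ (fun q => r q 1) p a = 0 := by
    simpa [hε0, h.normal_one_ne_zero hp h0] using h3
  refine h.eq_zero_of_fderiv_coord hp fun i => ?_
  fin_cases i
  exacts [h1, h4, h2]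

theorem surjective_ty (h : UmbilicPatch ε f N D r V δ lam) (hε : ε = 1 ∨ ε = -1)
    (hE : Module.finrank ℝ E = 2) {p : E} (hp : p ∈ D) (h0 : V p 2 = 0) :
    Function.Surjective ((fderiv ℝ (fun q => r q 0) p).prod (fderiv ℝ (fun q => r q 2) p)) := by
  have : FiniteDimensional ℝ E := FiniteDimensional.of_finrank_pos (by omega)
  exact (LinearMap.injective_iff_surjective_of_finrank_eq_finrank
    (f := ((fderiv ℝ (fun q => r q 0) p).prod (fderiv ℝ (fun q => r q 2) p)).toLinearMap)
    (by simp [hE])).1 (h.injective_ty hε hp h0)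

/-- Where `∂_t` is tangent, orthogonality to `V` makes `dx` a multiple of `dy` on the surface. -/
theorem fderiv_x_eq (h : UmbilicPatch ε f N D r V δ lam) (hε : ε = 1 ∨ ε = -1)
    {p : E} (hp : p ∈ D) (h0 : V p 2 = 0) (a : E) :
    fderiv ℝ (fun q => r q 1) p a = -(ε * V p 0 / V p 1) * fderiv ℝ (fun q => r q 2) p a := by
  have h2 : ε * ε = 1 := by rcases hε with rfl | rfl <;> norm_num
  have h1 := h.normal_one_ne_zero hp h0
  have h3 := h.normal_eq hp a
  rw [h0] at h3
  field_simp
  linear_combination ε * h3 - (fderiv ℝ (fun q => r q 1) p a) * V p 1 * h2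

/-- The field `∂_t` is tangent to the surface at `p` exactly when `⟨V, ∂_t⟩`, the third component
of `V`, vanishes at `p`. -/
theorem exists_fderiv_eq_dt_iff (h : UmbilicPatch ε f N D r V δ lam) (hε : ε = 1 ∨ ε = -1)
    (hE : Module.finrank ℝ E = 2) {p : E} (hp : p ∈ D) :
    (∃ a, fderiv ℝ r p a = dt) ↔ V p 2 = 0 := by
  constructor
  · rintro ⟨a, ha⟩
    have := h.normal p hp a
    rw [ha, walkerMetric_pair] at this
    simpa [dt] using this
  · intro h0
    obtain ⟨a, ha⟩ := h.surjective_ty hε hE hp h0 (1, 0)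
    have h1 : fderiv ℝ (fun q => r q 0) p a = 1 := congrArg Prod.fst ha
    have h2 : fderiv ℝ (fun q => r q 2) p a = 0 := congrArg Prod.snd ha
    refine ⟨a, ?_⟩
    ext i
    rw [h.fderiv_coord hp]
    fin_cases i
    · simpa [dt] using h1
    · simp [h.fderiv_x_eq hε hp h0, h2, dt]
    · simpa [dt] using h2

/-- The component of the umbilicity equation along `∂_y`, that is, `d⟨V, ∂_t⟩ = -lam dy`. -/
theorem fderiv_normal_two (h : UmbilicPatch ε f N D r V δ lam) (hε : ε = 1 ∨ ε = -1)
    (hN : IsOpen N) (hf : ∀ n, ContDiffOn ℝ ∞ (xDeriv n f) N)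
    {p : E} (hp : p ∈ D) (a : E) :
    fderiv ℝ (fun q => V q 2) p a = -(lam p * fderiv ℝ (fun q => r q 2) p a) := by
  have h1 := h.umbilic p hp a 2
  simp only [christoffel_walkerMetric hε ((hf 0).differentiableAt_of_isOpen hN (h.mem p hp)),
    Fin.sum_univ_three, h.fderiv_coord hp, h.fderiv_normal_coord hp] at h1
  simp at h1
  linear_combination -h1

/-- The component of the umbilicity equation along `∂_x`. -/
theorem fderiv_normal_one (h : UmbilicPatch ε f N D r V δ lam) (hε : ε = 1 ∨ ε = -1)
    (hN : IsOpen N) (hf : ∀ n, ContDiffOn ℝ ∞ (xDeriv n f) N)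
    {p : E} (hp : p ∈ D) (a : E) :
    fderiv ℝ (fun q => V q 1) p a = -(lam p * fderiv ℝ (fun q => r q 1) p a)
      + ε / 2 * xDeriv 1 f (r p) * V p 2 * fderiv ℝ (fun q => r q 2) p a := by
  have h1 := h.umbilic p hp a 1
  simp only [christoffel_walkerMetric hε ((hf 0).differentiableAt_of_isOpen hN (h.mem p hp)),
    Fin.sum_univ_three, h.fderiv_coord hp, h.fderiv_normal_coord hp] at h1
  simp at h1
  linear_combination -h1

/-- The component of the umbilicity equation along `∂_t`. -/
theorem fderiv_normal_zero (h : UmbilicPatch ε f N D r V δ lam) (hε : ε = 1 ∨ ε = -1)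
    (hN : IsOpen N) (hf : ∀ n, ContDiffOn ℝ ∞ (xDeriv n f) N)
    {p : E} (hp : p ∈ D) (a : E) :
    fderiv ℝ (fun q => V q 0) p a = -(lam p * fderiv ℝ (fun q => r q 0) p a)
      - xDeriv 1 f (r p) * V p 2 / 2 * fderiv ℝ (fun q => r q 1) p a
      - (xDeriv 1 f (r p) * V p 1 + pderiv3 2 (xDeriv 0 f) (r p) * V p 2) / 2
        * fderiv ℝ (fun q => r q 2) p a := by
  have h1 := h.umbilic p hp a 0
  simp only [christoffel_walkerMetric hε ((hf 0).differentiableAt_of_isOpen hN (h.mem p hp)),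
    Fin.sum_univ_three, h.fderiv_coord hp, h.fderiv_normal_coord hp] at h1
  simp at h1
  linear_combination -h1

theorem contDiffOn_comp (h : UmbilicPatch ε f N D r V δ lam) {u : Space3 → ℝ}
    (hu : ContDiffOn ℝ ∞ u N) :
    ContDiffOn ℝ ∞ (fun q => u (r q)) D :=
  hu.comp h.smooth h.mem

/-- The component of the Codazzi equation along `∂_y`: on the surface, `d lam ∧ dy = 0`. -/
theorem codazzi_two (h : UmbilicPatch ε f N D r V δ lam) (hε : ε = 1 ∨ ε = -1)
    (hN : IsOpen N) (hf : ∀ n, ContDiffOn ℝ ∞ (xDeriv n f) N)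
    {p : E} (hp : p ∈ D) (a b : E) :
    fderiv ℝ lam p a * fderiv ℝ (fun q => r q 2) p b
      = fderiv ℝ lam p b * fderiv ℝ (fun q => r q 2) p a := by
  have hw := sum_wedge_eq_zero_of_fderiv_eq h.isOpen (h.contDiffOn_normal 2)
    (α := ![fun q => -lam q]) (β := ![fun q => r q 2])
    (by simpa [Fin.forall_fin_one] using h.smooth_lam.neg)
    (by simpa [Fin.forall_fin_one] using h.contDiffOn_coord 2)
    (fun q hq c => by simpa using h.fderiv_normal_two hε hN hf hq c) hp a b
  simp [fderiv_fun_neg] at hw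
  linear_combination -hw

/-- The component of the Codazzi equation along `∂_x`. -/
theorem codazzi_one (h : UmbilicPatch ε f N D r V δ lam) (hε : ε = 1 ∨ ε = -1)
    (hN : IsOpen N) (hf : ∀ n, ContDiffOn ℝ ∞ (xDeriv n f) N)
    {p : E} (hp : p ∈ D) (a b : E) :
    fderiv ℝ lam p a * fderiv ℝ (fun q => r q 1) p b
        - fderiv ℝ lam p b * fderiv ℝ (fun q => r q 1) p a =
      ε / 2 * xDeriv 2 f (r p) * V p 2 *
        (fderiv ℝ (fun q => r q 1) p a * fderiv ℝ (fun q => r q 2) p b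
          - fderiv ℝ (fun q => r q 1) p b * fderiv ℝ (fun q => r q 2) p a) := by
  have s1 : ContDiffOn ℝ ∞ (fun q => xDeriv 1 f (r q)) D := h.contDiffOn_comp (hf 1)
  have s2 : ContDiffOn ℝ ∞ (fun q => ε / 2 * (xDeriv 1 f (r q) * V q 2)) D :=
    contDiffOn_const.mul (s1.mul (h.contDiffOn_normal 2))
  have hw := sum_wedge_eq_zero_of_fderiv_eq h.isOpen (h.contDiffOn_normal 1)
    (α := ![fun q => -lam q, fun q => ε / 2 * (xDeriv 1 f (r q) * V q 2)])
    (β := ![fun q => r q 1, fun q => r q 2])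
    (by simpa [Fin.forall_fin_two] using ⟨h.smooth_lam.neg, s2⟩)
    (by simpa [Fin.forall_fin_two] using ⟨h.contDiffOn_coord 1, h.contDiffOn_coord 2⟩)
    (fun q hq c => by
      rw [h.fderiv_normal_one hε hN hf hq c]
      simp only [Fin.sum_univ_two, Matrix.cons_val_zero, Matrix.cons_val_one]
      ring) hp a b
  have d1 := s1.differentiableAt_of_isOpen h.isOpen hp
  have d2 := (h.contDiffOn_normal 2).differentiableAt_of_isOpen h.isOpen hp
  simp (disch := fun_prop) only [Fin.sum_univ_two, Matrix.cons_val_zero, Matrix.cons_val_one,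
    fderiv_fun_neg, _root_.neg_apply, fderiv_mul_apply, fderiv_fun_const,
    h.fderiv_xDeriv_comp hN hf 1 hp, h.fderiv_normal_two hε hN hf hp] at hw
  simp at hw
  linear_combination -hw

/-- The component of the Codazzi equation along `∂_t`, at a point where `∂_t` is itself tangent. -/
theorem codazzi_zero (h : UmbilicPatch ε f N D r V δ lam) (hε : ε = 1 ∨ ε = -1)
    (hN : IsOpen N) (hf : ∀ n, ContDiffOn ℝ ∞ (xDeriv n f) N)
    {p : E} (hp : p ∈ D) (h0 : V p 2 = 0) {a : E} (ha : fderiv ℝ r p a = dt)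
    (b : E) :
    fderiv ℝ lam p b = fderiv ℝ lam p a * fderiv ℝ (fun q => r q 0) p b := by
  have ha' := fun i => (h.fderiv_coord hp a i).symm.trans (congrFun ha i)
  have ha0 : fderiv ℝ (fun q => r q 0) p a = 1 := by simpa [dt] using ha' 0
  have ha1 : fderiv ℝ (fun q => r q 1) p a = 0 := by simpa [dt] using ha' 1
  have ha2 : fderiv ℝ (fun q => r q 2) p a = 0 := by simpa [dt] using ha' 2
  have s1 : ContDiffOn ℝ ∞ (fun q => xDeriv 1 f (r q)) D := h.contDiffOn_comp (hf 1)
  have sy : ContDiffOn ℝ ∞ (fun q => pderiv3 2 (xDeriv 0 f) (r q)) D :=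
    h.contDiffOn_comp ((hf 0).pderiv3_of_isOpen hN 2)
  have s2 : ContDiffOn ℝ ∞ (fun q => xDeriv 1 f (r q) * V q 2) D :=
    s1.mul (h.contDiffOn_normal 2)
  have s3 : ContDiffOn ℝ ∞ (fun q => xDeriv 1 f (r q) * V q 1
      + pderiv3 2 (xDeriv 0 f) (r q) * V q 2) D :=
    (s1.mul (h.contDiffOn_normal 1)).add (sy.mul (h.contDiffOn_normal 2))
  have hw := sum_wedge_eq_zero_of_fderiv_eq h.isOpen (h.contDiffOn_normal 0)
    (α := ![fun q => -lam q, fun q => (xDeriv 1 f (r q) * V q 2) * (-1 / 2),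
      fun q => (xDeriv 1 f (r q) * V q 1 + pderiv3 2 (xDeriv 0 f) (r q) * V q 2) * (-1 / 2)])
    (β := ![fun q => r q 0, fun q => r q 1, fun q => r q 2])
    (by
      intro i
      fin_cases i
      · exact h.smooth_lam.neg
      · exact s2.mul contDiffOn_const
      · exact s3.mul contDiffOn_const)
    (by
      intro i
      fin_cases i
      exacts [h.contDiffOn_coord 0, h.contDiffOn_coord 1, h.contDiffOn_coord 2])
    (fun q hq c => by
      simp [h.fderiv_normal_zero hε hN hf hq c, Fin.sum_univ_three]
      ring) hp a b
  have d1 := s1.differentiableAt_of_isOpen h.isOpen hp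
  have dy := sy.differentiableAt_of_isOpen h.isOpen hp
  have dV1 := (h.contDiffOn_normal 1).differentiableAt_of_isOpen h.isOpen hp
  have dV2 := (h.contDiffOn_normal 2).differentiableAt_of_isOpen h.isOpen hp
  simp (disch := fun_prop) [Fin.sum_univ_three, fderiv_fun_neg, fderiv_mul_apply, fderiv_fun_add,
    h.fderiv_xDeriv_comp hN hf 1 hp, h.fderiv_normal_two hε hN hf hp,
    h.fderiv_normal_one hε hN hf hp, ha0, ha1, ha2, h0] at hw
  linear_combination hw

/-! ### Consequences of the Codazzi equation -/

/-- The equation `d lam = -(ε/2) ⟨V, ∂_t⟩ f_{xx} dy` on the surface. Where `∂_t` is tangent both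
sides vanish. -/
theorem fderiv_lam (h : UmbilicPatch ε f N D r V δ lam) (hε : ε = 1 ∨ ε = -1)
    (hN : IsOpen N) (hf : ∀ n, ContDiffOn ℝ ∞ (xDeriv n f) N) (hE : Module.finrank ℝ E = 2)
    {p : E} (hp : p ∈ D) (a : E) :
    fderiv ℝ lam p a =
      -(ε / 2 * xDeriv 2 f (r p) * V p 2) * fderiv ℝ (fun q => r q 2) p a := by
  by_cases h0 : V p 2 = 0
  · obtain ⟨c, hc⟩ := (h.exists_fderiv_eq_dt_iff hε hE hp).2 h0
    obtain ⟨b, hb⟩ := h.surjective_ty hε hE hp h0 (0, 1)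
    have hb2 : fderiv ℝ (fun q => r q 2) p b = 1 := congrArg Prod.snd hb
    have hc2 : fderiv ℝ (fun q => r q 2) p c = 0 := by
      rw [← h.fderiv_coord hp, hc]; simp [dt]
    have h1 := h.codazzi_two hε hN hf hp c b
    rw [hb2, hc2] at h1
    rw [h.codazzi_zero hε hN hf hp h0 hc a, h0]
    linear_combination (fderiv ℝ (fun q => r q 0) p a) * h1
  · obtain ⟨b, hb⟩ := h.surjective_xy hE hp h0 (1, 0)
    obtain ⟨c, hc⟩ := h.surjective_xy hE hp h0 (0, 1)
    have hb1 : fderiv ℝ (fun q => r q 1) p b = 1 := congrArg Prod.fst hb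
    have hb2 : fderiv ℝ (fun q => r q 2) p b = 0 := congrArg Prod.snd hb
    have hc2 : fderiv ℝ (fun q => r q 2) p c = 1 := congrArg Prod.snd hc
    have h1 := h.codazzi_two hε hN hf hp b c
    have h2 := h.codazzi_one hε hN hf hp a b
    rw [hb2, hc2] at h1
    rw [hb1, hb2] at h2
    linear_combination h2 + (fderiv ℝ (fun q => r q 1) p a) * h1

/-- Applying `d` to the formula for `d lam` gives `⟨V, ∂_t⟩ f_{xxx} dx ∧ dy = 0`. -/
theorem xDeriv_three_eq_zero (h : UmbilicPatch ε f N D r V δ lam) (hε : ε = 1 ∨ ε = -1)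
    (hN : IsOpen N) (hf : ∀ n, ContDiffOn ℝ ∞ (xDeriv n f) N) (hE : Module.finrank ℝ E = 2)
    {p : E} (hp : p ∈ D) (h0 : V p 2 ≠ 0) : xDeriv 3 f (r p) = 0 := by
  obtain ⟨b, hb⟩ := h.surjective_xy hE hp h0 (1, 0)
  obtain ⟨c, hc⟩ := h.surjective_xy hE hp h0 (0, 1)
  have hb1 : fderiv ℝ (fun q => r q 1) p b = 1 := congrArg Prod.fst hb
  have hb2 : fderiv ℝ (fun q => r q 2) p b = 0 := congrArg Prod.snd hb
  have hc2 : fderiv ℝ (fun q => r q 2) p c = 1 := congrArg Prod.snd hc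
  have s2 : ContDiffOn ℝ ∞ (fun q => xDeriv 2 f (r q)) D := h.contDiffOn_comp (hf 2)
  have s3 : ContDiffOn ℝ ∞ (fun q => xDeriv 2 f (r q) * V q 2) D :=
    s2.mul (h.contDiffOn_normal 2)
  have hw := sum_wedge_eq_zero_of_fderiv_eq h.isOpen h.smooth_lam
    (α := ![fun q => -(ε / 2) * (xDeriv 2 f (r q) * V q 2)]) (β := ![fun q => r q 2])
    (by simpa [Fin.forall_fin_one] using (contDiffOn_const (c := -(ε / 2))).mul s3)
    (by simpa [Fin.forall_fin_one] using h.contDiffOn_coord 2)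
    (fun q hq e => by
      rw [h.fderiv_lam hε hN hf hE hq e]
      simp only [Fin.sum_univ_one, Matrix.cons_val_zero]
      ring) hp b c
  have d2 := s2.differentiableAt_of_isOpen h.isOpen hp
  have dV := (h.contDiffOn_normal 2).differentiableAt_of_isOpen h.isOpen hp
  simp (disch := fun_prop) only [Fin.sum_univ_one, Matrix.cons_val_zero, fderiv_mul_apply,
    h.fderiv_xDeriv_comp hN hf 2 hp, h.fderiv_normal_two hε hN hf hp, fderiv_fun_const, hb1, hb2,
    hc2] at hw
  have hε0 : ε ≠ 0 := by rcases hε with rfl | rfl <;> norm_num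
  simpa [hε0, h0] using hw

/-- The pair `(⟨V, ∂_t⟩, lam)` solves a linear homogeneous system of differential equations along
every curve on the surface, so that its zeros form an open set. -/
theorem eventually_eq_zero (h : UmbilicPatch ε f N D r V δ lam) (hε : ε = 1 ∨ ε = -1)
    (hN : IsOpen N) (hf : ∀ n, ContDiffOn ℝ ∞ (xDeriv n f) N) (hE : Module.finrank ℝ E = 2)
    {p : E} (hp : p ∈ D) (h0 : V p 2 = 0) (hl : lam p = 0) :
    ∀ᶠ q in nhds p, V q 2 = 0 ∧ lam q = 0 := by
  obtain ⟨ρ, hρ, hball⟩ := Metric.isOpen_iff.1 h.isOpen p hp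
  filter_upwards [Metric.ball_mem_nhds p hρ] with q hq
  -- The system is integrated along the segment from `p` to `q`.
  let γ : ℝ → E := fun s => p + s • (q - p)
  have hγ : ∀ s ∈ Set.Icc (0 : ℝ) 1, γ s ∈ D := fun s hs =>
    hball ((convex_ball p ρ).add_smul_sub_mem (Metric.mem_ball_self hρ) hq hs)
  have hγd : ∀ s, HasDerivAt γ (q - p) s := by
    intro s
    simpa [γ] using ((hasDerivAt_id s).smul_const (q - p)).const_add p
  have hγc : Continuous γ := by fun_prop
  let y' : ℝ → ℝ := fun s => fderiv ℝ (fun z => r z 2) (γ s) (q - p)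
  let c : ℝ → ℝ := fun s => ε / 2 * xDeriv 2 f (r (γ s))
  have hy' : ContinuousOn y' (Set.Icc 0 1) :=
    ((h.contDiffOn_coord 2).fderiv_apply_of_isOpen h.isOpen (q - p)).continuousOn.comp
      hγc.continuousOn hγ
  have hc : ContinuousOn c (Set.Icc 0 1) :=
    continuousOn_const.mul ((h.contDiffOn_comp (hf 2)).continuousOn.comp hγc.continuousOn hγ)
  obtain ⟨K₁, hK₁⟩ := isCompact_Icc.exists_bound_of_continuousOn hy'
  obtain ⟨K₂, hK₂⟩ := isCompact_Icc.exists_bound_of_continuousOn hc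
  have hd : ∀ s ∈ Set.Icc (0 : ℝ) 1, HasDerivAt (fun s => (V (γ s) 2, lam (γ s)))
      (-(lam (γ s) * y' s), -(c s * V (γ s) 2) * y' s) s := by
    intro s hs
    have h1 := ((h.contDiffOn_normal 2).differentiableAt_of_isOpen h.isOpen
      (hγ s hs)).hasFDerivAt.comp_hasDerivAt s (hγd s)
    have h2 := (h.smooth_lam.differentiableAt_of_isOpen h.isOpen
      (hγ s hs)).hasFDerivAt.comp_hasDerivAt s (hγd s)
    rw [h.fderiv_normal_two hε hN hf (hγ s hs)] at h1
    rw [h.fderiv_lam hε hN hf hE (hγ s hs)] at h2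
    exact h1.prodMk h2
  have hK₁0 : 0 ≤ K₁ := (norm_nonneg _).trans (hK₁ 0 (by simp))
  have hK₂0 : 0 ≤ K₂ := (norm_nonneg _).trans (hK₂ 0 (by simp))
  have hz := eq_zero_of_abs_deriv_le_mul_abs_self_of_eq_zero_right
    (f := fun s => (V (γ s) 2, lam (γ s))) (K := (1 + K₂) * K₁)
    (fun s hs => (hd s hs).continuousAt.continuousWithinAt)
    (fun s hs => (hd s (Set.Ico_subset_Icc_self hs)).hasDerivWithinAt)
    (by simp [γ, h0, hl]) (fun s hs => ?_) 1 (by simp)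
  · simpa [γ] using hz
  · have b1 := hK₁ s (Set.Ico_subset_Icc_self hs)
    have b2 := hK₂ s (Set.Ico_subset_Icc_self hs)
    have n1 : ‖V (γ s) 2‖ ≤ ‖(V (γ s) 2, lam (γ s))‖ := norm_fst_le (V (γ s) 2, lam (γ s))
    have n2 : ‖lam (γ s)‖ ≤ ‖(V (γ s) 2, lam (γ s))‖ := norm_snd_le (V (γ s) 2, lam (γ s))
    have nn := norm_nonneg (V (γ s) 2, lam (γ s))
    rw [Prod.norm_mk, max_le_iff, norm_neg, norm_mul, norm_mul, norm_neg, norm_mul]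
    have m1 : ‖lam (γ s)‖ * ‖y' s‖ ≤ ‖(V (γ s) 2, lam (γ s))‖ * K₁ := by gcongr
    have m2 : ‖c s‖ * ‖V (γ s) 2‖ * ‖y' s‖ ≤ K₂ * ‖(V (γ s) 2, lam (γ s))‖ * K₁ := by gcongr
    have m3 : 0 ≤ K₂ * ‖(V (γ s) 2, lam (γ s))‖ * K₁ := by positivity
    have m4 : 0 ≤ ‖(V (γ s) 2, lam (γ s))‖ * K₁ := by positivity
    constructor <;> linarith

/-- Where `∂_t` is tangent to the surface and the umbilicity factor vanishes, the surface is
ruled by the lines in the direction `∂_t`, over a solution of `x'' = (ε/2) f_x(x, y)`. -/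
theorem exists_bijOn_graph (h : UmbilicPatch ε f N D r V δ lam) (hε : ε = 1 ∨ ε = -1)
    (hN : IsOpen N) (hf : ∀ n, ContDiffOn ℝ ∞ (xDeriv n f) N) (hE : Module.finrank ℝ E = 2)
    (h0 : ∀ p ∈ D, V p 2 = 0) (hl : ∀ p ∈ D, lam p = 0) {p : E} (hp : p ∈ D) :
    ∃ W ⊆ D, IsOpen W ∧ p ∈ W ∧ ∃ (a b c d : ℝ) (x : ℝ → ℝ),
      ContDiffOn ℝ ∞ x (Set.Ioo c d) ∧
      (∀ v ∈ Set.Ioo c d,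
        iteratedDeriv 2 x v - ε / 2 * deriv (fun s => f s v) (x v) = 0) ∧
      Set.BijOn r W {p : Space3 | p 0 ∈ Set.Ioo a b ∧ p 2 ∈ Set.Ioo c d ∧ p 1 = x (p 2)} := by
  have : FiniteDimensional ℝ E := FiniteDimensional.of_finrank_pos (by omega)
  have : CompleteSpace E := FiniteDimensional.complete ℝ E
  let ψ : E → ℝ × ℝ := fun q => (r q 0, r q 2)
  let ψ' : ∀ q ∈ D, E ≃L[ℝ] ℝ × ℝ := fun q hq =>
    ContinuousLinearEquiv.ofBijective
      ((fderiv ℝ (fun z => r z 0) q).prod (fderiv ℝ (fun z => r z 2) q))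
      (LinearMap.ker_eq_bot.2 (h.injective_ty hε hq (h0 q hq)))
      (LinearMap.range_eq_top.2 (h.surjective_ty hε hE hq (h0 q hq)))
  have hψ : ContDiffOn ℝ ∞ ψ D := (h.contDiffOn_coord 0).prodMk (h.contDiffOn_coord 2)
  have hψd : ∀ q (hq : q ∈ D), HasFDerivAt ψ (ψ' q hq : E →L[ℝ] ℝ × ℝ) q := fun q hq =>
    ((h.contDiffOn_coord 0).differentiableAt_of_isOpen h.isOpen hq).hasFDerivAt.prodMk
      ((h.contDiffOn_coord 2).differentiableAt_of_isOpen h.isOpen hq).hasFDerivAt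
  -- The inverse of `e` parametrises the surface by `(t, y)`.
  let e : OpenPartialHomeomorph E (ℝ × ℝ) :=
    ((hψ.contDiffAt (h.isOpen.mem_nhds hp)).toOpenPartialHomeomorph ψ (hψd p hp)
      (by simp)).restrOpen D h.isOpen
  have heD : e.source ⊆ D := Set.inter_subset_right
  have hep : p ∈ e.source :=
    ⟨(hψ.contDiffAt (h.isOpen.mem_nhds hp)).mem_toOpenPartialHomeomorph_source (hψd p hp)
      (by simp), hp⟩
  have heψ : ∀ q, e q = ψ q := fun q => rfl
  obtain ⟨η, hη, hball⟩ := Metric.isOpen_iff.1 e.open_target (ψ p) (e.map_source hep)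
  rw [← ball_prod_same, Real.ball_eq_Ioo, Real.ball_eq_Ioo] at hball
  set a := (ψ p).1 - η
  set b := (ψ p).1 + η
  set c := (ψ p).2 - η
  set d := (ψ p).2 + η
  have ht₀ : (ψ p).1 ∈ Set.Ioo a b := ⟨by simp [a, hη], by simp [b, hη]⟩
  have hy₀ : (ψ p).2 ∈ Set.Ioo c d := ⟨by simp [c, hη], by simp [d, hη]⟩
  have hgD : ∀ z ∈ Set.Ioo a b ×ˢ Set.Ioo c d, e.symm z ∈ D := fun z hz =>
    heD (e.map_target (hball hz))
  have hgψ : ∀ z ∈ Set.Ioo a b ×ˢ Set.Ioo c d, ψ (e.symm z) = z := fun z hz =>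
    e.right_inv (hball hz)
  have hgd : ∀ z (hz : z ∈ Set.Ioo a b ×ˢ Set.Ioo c d), HasFDerivAt e.symm
      ((ψ' _ (hgD z hz)).symm : ℝ × ℝ →L[ℝ] E) z := fun z hz =>
    e.hasFDerivAt_symm (hball hz) (hψd _ (hgD z hz))
  have hgs : ContDiffOn ℝ ∞ e.symm (Set.Ioo a b ×ˢ Set.Ioo c d) := fun z hz =>
    (e.contDiffAt_symm (hball hz) (hψd _ (hgD z hz))
      (hψ.contDiffAt (h.isOpen.mem_nhds (hgD z hz)))).contDiffWithinAt
  have hy' : ∀ z (hz : z ∈ Set.Ioo a b ×ˢ Set.Ioo c d) w,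
      fderiv ℝ (fun q => r q 2) (e.symm z) ((ψ' _ (hgD z hz)).symm w) = w.2 := fun z hz w =>
    congrArg Prod.snd ((ψ' _ (hgD z hz)).apply_symm_apply w)
  have hx' : ∀ z (hz : z ∈ Set.Ioo a b ×ˢ Set.Ioo c d) w,
      fderiv ℝ (fun q => r q 1) (e.symm z) ((ψ' _ (hgD z hz)).symm w) =
        -(ε * V (e.symm z) 0 / V (e.symm z) 1) * w.2 := by
    intro z hz w
    rw [h.fderiv_x_eq hε (hgD z hz) (h0 _ (hgD z hz)), hy' z hz]
  -- The derivative of a function on the surface along the coordinate line `t = (ψ p).1`.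
  have hcurve : ∀ (u : E → ℝ), ContDiffOn ℝ ∞ u D → ∀ s (hs : s ∈ Set.Ioo c d),
      HasDerivAt (fun σ => u (e.symm ((ψ p).1, σ)))
        (fderiv ℝ u (e.symm ((ψ p).1, s)) ((ψ' _ (hgD ((ψ p).1, s) ⟨ht₀, hs⟩)).symm (0, 1))) s := by
    intro u hu s hs
    have h1 := (hu.differentiableAt_of_isOpen h.isOpen
      (hgD ((ψ p).1, s) ⟨ht₀, hs⟩)).hasFDerivAt.comp ((ψ p).1, s) (hgd ((ψ p).1, s) ⟨ht₀, hs⟩)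
    exact h1.comp_hasDerivAt s ((hasDerivAt_const s (ψ p).1).prodMk (hasDerivAt_id s))
  let x : ℝ → ℝ := fun s => r (e.symm ((ψ p).1, s)) 1
  have hxs : ContDiffOn ℝ ∞ x (Set.Ioo c d) :=
    (h.contDiffOn_coord 1).comp (hgs.comp (by fun_prop) fun s hs => ⟨ht₀, hs⟩)
      fun s hs => hgD _ ⟨ht₀, hs⟩
  have hxd : ∀ s ∈ Set.Ioo c d, HasDerivAt x
      (-(ε * V (e.symm ((ψ p).1, s)) 0 / V (e.symm ((ψ p).1, s)) 1)) s := by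
    intro s hs
    have h1 := hcurve _ (h.contDiffOn_coord 1) s hs
    rwa [hx' ((ψ p).1, s) ⟨ht₀, hs⟩, mul_one] at h1
  -- The coordinate `x` depends on `y` only, because `dx` is a multiple of `dy`.
  have hindep : ∀ z ∈ Set.Ioo a b ×ˢ Set.Ioo c d, r (e.symm z) 1 = x z.2 := by
    rintro ⟨t, y⟩ ⟨ht, hy⟩
    have hd : ∀ τ ∈ Set.Ioo a b, HasDerivAt (fun τ => r (e.symm (τ, y)) 1) 0 τ := by
      intro τ hτ
      have h1 := ((h.contDiffOn_coord 1).differentiableAt_of_isOpen h.isOpen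
        (hgD (τ, y) ⟨hτ, hy⟩)).hasFDerivAt.comp (τ, y) (hgd (τ, y) ⟨hτ, hy⟩)
      have h2 := h1.comp_hasDerivAt τ ((hasDerivAt_id τ).prodMk (hasDerivAt_const τ y))
      rw [ContinuousLinearMap.comp_apply, ContinuousLinearEquiv.coe_coe,
        hx' (τ, y) ⟨hτ, hy⟩, mul_zero] at h2
      exact h2
    exact isOpen_Ioo.is_const_of_deriv_eq_zero isPreconnected_Ioo
      (fun τ hτ => (hd τ hτ).differentiableAt.differentiableWithinAt)
      (fun τ hτ => (hd τ hτ).deriv) ht ht₀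
  refine ⟨e.source ∩ e ⁻¹' (Set.Ioo a b ×ˢ Set.Ioo c d), Set.inter_subset_left.trans heD,
    e.isOpen_inter_preimage (isOpen_Ioo.prod isOpen_Ioo), ⟨hep, ht₀, hy₀⟩, a, b, c, d, x, hxs,
    fun s hs => ?_, ?_, ?_, ?_⟩
  · have hsD := hgD ((ψ p).1, s) ⟨ht₀, hs⟩
    have hV1 := h.normal_one_ne_zero hsD (h0 _ hsD)
    have e1 : deriv x =ᶠ[nhds s]
        fun s => -(ε * V (e.symm ((ψ p).1, s)) 0 / V (e.symm ((ψ p).1, s)) 1) := by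
      filter_upwards [isOpen_Ioo.mem_nhds hs] with σ hσ using (hxd σ hσ).deriv
    have d0 := hcurve _ (h.contDiffOn_normal 0) s hs
    have d1 := hcurve _ (h.contDiffOn_normal 1) s hs
    rw [h.fderiv_normal_zero hε hN hf hsD, h0 _ hsD, hl _ hsD, hy' ((ψ p).1, s) ⟨ht₀, hs⟩] at d0
    rw [h.fderiv_normal_one hε hN hf hsD, h0 _ hsD, hl _ hsD] at d1
    have d2 := (((d0.const_mul ε).div d1 hV1).fun_neg).deriv
    have hfx : deriv (fun σ => f σ s) (x s) = xDeriv 1 f (r (e.symm ((ψ p).1, s))) := by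
      have h2 : r (e.symm ((ψ p).1, s)) 2 = s := congrArg Prod.snd (hgψ ((ψ p).1, s) ⟨ht₀, hs⟩)
      rw [xDeriv_one, h2]
    rw [iteratedDeriv_succ, iteratedDeriv_one, e1.deriv_eq, hfx]
    refine (congrArg (· - _) d2).trans ?_
    field_simp
    ring
  · intro q hq
    have h1 := hindep _ hq.2
    rw [e.left_inv hq.1] at h1
    exact ⟨hq.2.1, hq.2.2, h1⟩
  · intro q hq q' hq' hqq
    exact e.injOn hq.1 hq'.1 (by simp only [heψ, ψ, hqq])
  · rintro P ⟨hP0, hP2, hP1⟩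
    have hz : (P 0, P 2) ∈ Set.Ioo a b ×ˢ Set.Ioo c d := ⟨hP0, hP2⟩
    refine ⟨e.symm (P 0, P 2), ⟨e.map_target (hball hz), ?_⟩, ?_⟩
    · rw [Set.mem_preimage, heψ, hgψ _ hz]
      exact hz
    · ext i
      fin_cases i
      · exact congrArg Prod.fst (hgψ _ hz)
      · exact (hindep _ hz).trans hP1.symm
      · exact congrArg Prod.snd (hgψ _ hz)
end UmbilicPatch

/-! ### Umbilical surfaces as immersed manifolds -/

section Surface

variable {M : Type*} [TopologicalSpace M] [ChartedSpace (EuclideanSpace ℝ (Fin 2)) M]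

/-- Over the open set `W`, the surface `ι` is totally umbilical with unit normal field `V`,
`⟨V, V⟩ = δ`, and umbilicity factor `lam`. -/
structure IsUmbilicOn (G : Metric3) (ι : M → Space3) (W : Set M) (V : M → Space3) (δ : ℝ)
    (lam : M → ℝ) : Prop where
  isOpen : IsOpen W
  unitNormal : IsUnitNormalOn G ι W V δ
  smooth_lam : ContMDiffOn (𝓡 2) 𝓘(ℝ, ℝ) ∞ lam W
  umbilic : ∀ m ∈ W, ∀ T : TangentSpace (𝓡 2) m, -covDerivAlong G ι V m T = lam m • surfDeriv ι m T

/-- The part of the chart at `m₀` that is mapped into `W`. -/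
def chartDomain (W : Set M) (m₀ : M) : Set (EuclideanSpace ℝ (Fin 2)) :=
  (extChartAt (𝓡 2) m₀).target ∩ (extChartAt (𝓡 2) m₀).symm ⁻¹' W

variable {ε : ℝ} {f : ℝ → ℝ → ℝ} {N : Set Space3} {ι : M → Space3} {W : Set M} {V : M → Space3}
  {δ : ℝ} {lam : M → ℝ}

theorem isOpen_chartDomain (hW : IsOpen W) (m₀ : M) : IsOpen (chartDomain W m₀) :=
  (continuousOn_extChartAt_symm m₀).isOpen_inter_preimage (isOpen_extChartAt_target m₀) hW

theorem map_extChartAt_mem_chartDomain {m : M} (hm : m ∈ W) :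
    extChartAt (𝓡 2) m m ∈ chartDomain W m :=
  ⟨mem_extChartAt_target m, by simpa [extChartAt_to_inv] using hm⟩

theorem IsTotallyUmbilical.exists_isUmbilicOn {G : Metric3} (h : IsTotallyUmbilical G ι) (m : M) :
    ∃ W V δ lam, IsUmbilicOn G ι W V δ lam ∧ m ∈ W := by
  obtain ⟨W, hW, hm, V, δ, lam, hV, hl, hu⟩ := h m
  exact ⟨W, V, δ, lam, ⟨hW, hV, hl, hu⟩, hm⟩

theorem IsUmbilicOn.continuousAt_normal {G : Metric3}
    (h : IsUmbilicOn G ι W V δ lam) {m : M} (hm : m ∈ W) (i : Fin 3) :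
    ContinuousAt (fun q => V q i) m :=
  (continuous_apply i).continuousAt.comp
    (h.unitNormal.smooth.continuousOn.continuousAt (h.isOpen.mem_nhds hm))

variable [IsManifold (𝓡 2) ∞ M]

theorem ContMDiffOn.contDiffOn_chartDomain {F : Type*} [NormedAddCommGroup F] [NormedSpace ℝ F]
    {u : M → F} (hu : ContMDiffOn (𝓡 2) 𝓘(ℝ, F) ∞ u W) (m₀ : M) :
    ContDiffOn ℝ ∞ (u ∘ (extChartAt (𝓡 2) m₀).symm) (chartDomain W m₀) := by
  rw [← contMDiffOn_iff_contDiffOn]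
  exact hu.comp ((contMDiffOn_extChartAt_symm m₀).mono Set.inter_subset_left) fun z hz => hz.2

/-- In a chart, `surfDeriv` becomes the Fréchet derivative, up to a bijective change of the tangent
vector that is the same for all maps. -/
theorem exists_surfDeriv_eq (hW : IsOpen W) (m₀ : M) {z : EuclideanSpace ℝ (Fin 2)}
    (hz : z ∈ chartDomain W m₀) :
    ∃ A : EuclideanSpace ℝ (Fin 2) → TangentSpace (𝓡 2) ((extChartAt (𝓡 2) m₀).symm z),
      A 0 = 0 ∧ Function.Bijective A ∧
      ∀ u : M → Space3, ContMDiffOn (𝓡 2) 𝓘(ℝ, Space3) ∞ u W → ∀ a,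
        surfDeriv u ((extChartAt (𝓡 2) m₀).symm z) (A a) =
          fderiv ℝ (u ∘ (extChartAt (𝓡 2) m₀).symm) z a := by
  have hms : (extChartAt (𝓡 2) m₀).symm z ∈ (extChartAt (𝓡 2) m₀).source :=
    (extChartAt (𝓡 2) m₀).map_target hz.1
  obtain ⟨e, he⟩ := isInvertible_mfderiv_extChartAt (I := 𝓡 2) hms
  refine ⟨fun a => e.symm a, map_zero _, e.symm.bijective, fun u hu a => ?_⟩
  have hd1 : MDifferentiableAt (𝓡 2) 𝓘(ℝ, EuclideanSpace ℝ (Fin 2)) (extChartAt (𝓡 2) m₀)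
      ((extChartAt (𝓡 2) m₀).symm z) :=
    mdifferentiableAt_extChartAt (by rwa [extChartAt_source] at hms)
  have hzr : extChartAt (𝓡 2) m₀ ((extChartAt (𝓡 2) m₀).symm z) = z :=
    (extChartAt (𝓡 2) m₀).right_inv hz.1
  have hd2 : DifferentiableAt ℝ (u ∘ (extChartAt (𝓡 2) m₀).symm) z :=
    (hu.contDiffOn_chartDomain m₀).differentiableAt_of_isOpen (isOpen_chartDomain hW m₀) hz
  have hu' : u =ᶠ[nhds ((extChartAt (𝓡 2) m₀).symm z)]
      (u ∘ (extChartAt (𝓡 2) m₀).symm) ∘ extChartAt (𝓡 2) m₀ := by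
    filter_upwards [extChartAt_source_mem_nhds' hms] with m hm
    simp only [Function.comp_apply, (extChartAt (𝓡 2) m₀).left_inv hm]
  have hd3 : MDifferentiableAt 𝓘(ℝ, EuclideanSpace ℝ (Fin 2)) 𝓘(ℝ, Space3)
      (u ∘ (extChartAt (𝓡 2) m₀).symm)
      (extChartAt (𝓡 2) m₀ ((extChartAt (𝓡 2) m₀).symm z)) := by
    rw [hzr]; exact hd2.mdifferentiableAt
  have key : mfderiv (𝓡 2) 𝓘(ℝ, Space3) u ((extChartAt (𝓡 2) m₀).symm z) = _ :=
    hu'.mfderiv_eq.trans (mfderiv_comp _ hd3 hd1)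
  have hA : mfderiv (𝓡 2) 𝓘(ℝ, EuclideanSpace ℝ (Fin 2)) (extChartAt (𝓡 2) m₀)
      ((extChartAt (𝓡 2) m₀).symm z) (e.symm a) = a := by
    rw [← he]; exact e.apply_symm_apply a
  unfold surfDeriv
  rw [key]
  refine (congrArg (mfderiv 𝓘(ℝ, EuclideanSpace ℝ (Fin 2)) 𝓘(ℝ, Space3)
    (u ∘ (extChartAt (𝓡 2) m₀).symm)
    (extChartAt (𝓡 2) m₀ ((extChartAt (𝓡 2) m₀).symm z))) hA).trans ?_
  rw [mfderiv_eq_fderiv, hzr]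
  rfl

theorem IsUmbilicOn.umbilicPatch (hι : IsNondegenerateSurface (walkerMetric ε f) N ι)
    (h : IsUmbilicOn (walkerMetric ε f) ι W V δ lam) (m₀ : M) :
    UmbilicPatch ε f N (chartDomain W m₀) (ι ∘ (extChartAt (𝓡 2) m₀).symm)
      (V ∘ (extChartAt (𝓡 2) m₀).symm) δ (lam ∘ (extChartAt (𝓡 2) m₀).symm) where
  isOpen := isOpen_chartDomain h.isOpen m₀
  smooth := hι.smooth.contMDiffOn.contDiffOn_chartDomain m₀
  mem := fun z _ => hι.mem _
  nondegenerate := by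
    intro z hz a ha
    obtain ⟨A, hA0, hA, hs⟩ := exists_surfDeriv_eq h.isOpen m₀ hz
    have hs' := hs ι hι.smooth.contMDiffOn
    refine hA.1 ((hι.nondegenerate _ _ fun T' => ?_).trans hA0.symm)
    obtain ⟨b, rfl⟩ := hA.2 T'
    rw [hs', hs']
    exact ha b
  smooth_normal := h.unitNormal.smooth.contDiffOn_chartDomain m₀
  sign := h.unitNormal.sign
  normal := by
    intro z hz a
    obtain ⟨A, -, -, hs⟩ := exists_surfDeriv_eq h.isOpen m₀ hz
    rw [← hs ι hι.smooth.contMDiffOn]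
    exact h.unitNormal.normal _ hz.2 _
  unit := fun z hz => h.unitNormal.unit _ hz.2
  smooth_lam := h.smooth_lam.contDiffOn_chartDomain m₀
  umbilic := by
    intro z hz a k
    obtain ⟨A, -, -, hs⟩ := exists_surfDeriv_eq h.isOpen m₀ hz
    have h1 := congrFun (h.umbilic _ hz.2 (A a)) k
    rw [← hs ι hι.smooth.contMDiffOn, ← hs V h.unitNormal.smooth]
    exact h1

theorem IsUmbilicOn.notMem_transversePoints_iff (hε : ε = 1 ∨ ε = -1)
    (hι : IsNondegenerateSurface (walkerMetric ε f) N ι)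
    (h : IsUmbilicOn (walkerMetric ε f) ι W V δ lam) {m : M} (hm : m ∈ W) :
    m ∉ transversePoints ι ↔ V m 2 = 0 := by
  have hz := map_extChartAt_mem_chartDomain hm
  have hp := (h.umbilicPatch hι m).exists_fderiv_eq_dt_iff hε (by simp) hz
  obtain ⟨A, -, hA, hs⟩ := exists_surfDeriv_eq h.isOpen m hz
  rw [Function.comp_apply, extChartAt_to_inv] at hp
  rw [← hp, transversePoints, Set.mem_ofPred_eq]
  push Not
  have h1 : (∃ T : TangentSpace (𝓡 2) ((extChartAt (𝓡 2) m).symm (extChartAt (𝓡 2) m m)),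
      surfDeriv ι _ T = dt) ↔ ∃ T : TangentSpace (𝓡 2) m, surfDeriv ι m T = dt := by
    rw [extChartAt_to_inv]
  rw [← h1, hA.2.exists]
  simp only [hs ι hι.smooth.contMDiffOn]

theorem isOpen_transversePoints (hε : ε = 1 ∨ ε = -1)
    (hι : IsNondegenerateSurface (walkerMetric ε f) N ι)
    (hu : IsTotallyUmbilical (walkerMetric ε f) ι) : IsOpen (transversePoints ι) := by
  rw [isOpen_iff_mem_nhds]
  intro m hm
  obtain ⟨W, V, δ, lam, h, hmW⟩ := hu.exists_isUmbilicOn m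
  have h0 : V m 2 ≠ 0 := fun h0 => (h.notMem_transversePoints_iff hε hι hmW).2 h0 hm
  filter_upwards [(h.continuousAt_normal hmW 2).eventually_ne h0, h.isOpen.mem_nhds hmW]
    with q hq hqW
  by_contra hqt
  exact hq ((h.notMem_transversePoints_iff hε hι hqW).1 hqt)

theorem xDeriv_three_eq_zero_of_mem_transversePoints (hε : ε = 1 ∨ ε = -1) (hN : IsOpen N)
    (hf : ∀ n, ContDiffOn ℝ ∞ (xDeriv n f) N)
    (hι : IsNondegenerateSurface (walkerMetric ε f) N ι)
    (hu : IsTotallyUmbilical (walkerMetric ε f) ι) {m : M} (hm : m ∈ transversePoints ι) :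
    xDeriv 3 f (ι m) = 0 := by
  obtain ⟨W, V, δ, lam, h, hmW⟩ := hu.exists_isUmbilicOn m
  have h0 : V m 2 ≠ 0 := fun h0 => (h.notMem_transversePoints_iff hε hι hmW).2 h0 hm
  have := (h.umbilicPatch hι m).xDeriv_three_eq_zero hε hN hf (by simp)
    (map_extChartAt_mem_chartDomain hmW) (by simpa [extChartAt_to_inv] using h0)
  simpa only [Function.comp_apply, extChartAt_to_inv] using this

theorem xDeriv_three_eq_zero_of_mem_transverseCylinder (hε : ε = 1 ∨ ε = -1) (hN : IsOpen N)
    (hf : ∀ n, ContDiffOn ℝ ∞ (xDeriv n f) N)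
    (hι : IsNondegenerateSurface (walkerMetric ε f) N ι)
    (hu : IsTotallyUmbilical (walkerMetric ε f) ι) {p : Space3}
    (hp : p ∈ transverseCylinder N ι) : xDeriv 3 f p = 0 := by
  obtain ⟨-, m, hm, h1, h2⟩ := hp
  have := xDeriv_three_eq_zero_of_mem_transversePoints hε hN hf hι hu hm
  simpa only [xDeriv, h1, h2] using this

/-- At a transverse point the projection of the surface to the coordinates `(x, y)` is a local
diffeomorphism. -/
theorem isOpen_transverseCylinder (hε : ε = 1 ∨ ε = -1) (hN : IsOpen N)
    (hι : IsNondegenerateSurface (walkerMetric ε f) N ι)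
    (hu : IsTotallyUmbilical (walkerMetric ε f) ι) : IsOpen (transverseCylinder N ι) := by
  have hopen : IsOpen ((fun m => (ι m 1, ι m 2)) '' transversePoints ι) := by
    rw [isOpen_iff_mem_nhds]
    rintro - ⟨m, hm, rfl⟩
    obtain ⟨W, V, δ, lam, h, hmW⟩ := hu.exists_isUmbilicOn m
    have h0 : V m 2 ≠ 0 := fun h0 => (h.notMem_transversePoints_iff hε hι hmW).2 h0 hm
    have hP := h.umbilicPatch hι m
    have hz := map_extChartAt_mem_chartDomain hmW
    have hsurj := hP.surjective_xy (by simp) hz (by simpa [extChartAt_to_inv] using h0)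
    have hs := fun i => ((hP.contDiffOn_coord i).contDiffAt
      (hP.isOpen.mem_nhds hz)).hasStrictFDerivAt (by simp)
    have hmap := ((hs 1).prodMk (hs 2)).map_nhds_eq_of_surj (LinearMap.range_eq_top.2 hsurj)
    have hT : (extChartAt (𝓡 2) m).symm ⁻¹' transversePoints ι ∈
        nhds (extChartAt (𝓡 2) m m) := by
      refine (continuousAt_extChartAt_symm m).preimage_mem_nhds ?_
      rw [extChartAt_to_inv]
      exact (isOpen_transversePoints hε hι hu).mem_nhds hm
    have himg := Filter.image_mem_map (m := fun z =>
      (ι ((extChartAt (𝓡 2) m).symm z) 1, ι ((extChartAt (𝓡 2) m).symm z) 2)) hT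
    rw [show Filter.map (fun z => (ι ((extChartAt (𝓡 2) m).symm z) 1,
      ι ((extChartAt (𝓡 2) m).symm z) 2)) (nhds (extChartAt (𝓡 2) m m)) = _ from hmap] at himg
    simp only [Function.comp_apply, extChartAt_to_inv] at himg
    refine Filter.mem_of_superset himg ?_
    rintro - ⟨z, hz, rfl⟩
    exact ⟨_, hz, rfl⟩
  have heq : transverseCylinder N ι =
      N ∩ (fun p : Space3 => (p 1, p 2)) ⁻¹' ((fun m => (ι m 1, ι m 2)) '' transversePoints ι) := by
    ext p
    simp [transverseCylinder, Prod.ext_iff]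
  rw [heq]
  exact hN.inter (hopen.preimage (by fun_prop))

/-- Where `⟨V, ∂_t⟩` vanishes on an open set, `0 = d⟨V, ∂_t⟩ = -lam dy`, and `dy` is not zero on the
surface. -/
theorem IsUmbilicOn.lam_eq_zero (hε : ε = 1 ∨ ε = -1) (hN : IsOpen N)
    (hf : ∀ n, ContDiffOn ℝ ∞ (xDeriv n f) N)
    (hι : IsNondegenerateSurface (walkerMetric ε f) N ι)
    (h : IsUmbilicOn (walkerMetric ε f) ι W V δ lam) {m : M} (hm : m ∈ W)
    (h0 : ∀ᶠ q in nhds m, q ∉ transversePoints ι) : lam m = 0 := by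
  have hP := h.umbilicPatch hι m
  have hz := map_extChartAt_mem_chartDomain hm
  have h1 : ∀ᶠ q in nhds m, V q 2 = 0 := by
    filter_upwards [h0, h.isOpen.mem_nhds hm] with q hq hqW
    exact (h.notMem_transversePoints_iff hε hι hqW).1 hq
  have h2 : ∀ᶠ z in nhds (extChartAt (𝓡 2) m m), V ((extChartAt (𝓡 2) m).symm z) 2 = 0 := by
    refine (continuousAt_extChartAt_symm (I := 𝓡 2) m).eventually (p := fun q => V q 2 = 0) ?_
    rwa [extChartAt_to_inv]
  obtain ⟨b, hb⟩ := hP.surjective_ty hε (by simp) hz h2.self_of_nhds (0, 1)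
  have hb2 := congrArg Prod.snd hb
  have h3 := hP.fderiv_normal_two hε hN hf hz b
  have h4 : (fun z => (V ∘ (extChartAt (𝓡 2) m).symm) z 2) =ᶠ[nhds (extChartAt (𝓡 2) m m)]
    fun _ => 0 := h2
  rw [h4.fderiv_eq] at h3
  simp only [ContinuousLinearMap.prod_apply] at hb2
  rw [hb2] at h3
  simpa [extChartAt_to_inv] using h3

/-- The interior of the set of points where `∂_t` is tangent to the surface is closed. -/
theorem isClosed_interior_compl_transversePoints (hε : ε = 1 ∨ ε = -1) (hN : IsOpen N)
    (hf : ∀ n, ContDiffOn ℝ ∞ (xDeriv n f) N)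
    (hι : IsNondegenerateSurface (walkerMetric ε f) N ι)
    (hu : IsTotallyUmbilical (walkerMetric ε f) ι) :
    IsClosed (interior (transversePoints ι)ᶜ) := by
  rw [← closure_subset_iff_isClosed]
  intro m hm
  obtain ⟨W, V, δ, lam, h, hmW⟩ := hu.exists_isUmbilicOn m
  rw [mem_closure_iff_frequently] at hm
  have hfreq : ∃ᶠ q in nhds m, V q 2 = 0 ∧ lam q = 0 := by
    refine (hm.and_eventually (h.isOpen.mem_nhds hmW)).mono fun q hq => ?_
    have hq0 : ∀ᶠ z in nhds q, z ∉ transversePoints ι := mem_interior_iff_mem_nhds.1 hq.1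
    exact ⟨(h.notMem_transversePoints_iff hε hι hq.2).1 hq0.self_of_nhds,
      h.lam_eq_zero hε hN hf hι hq.2 hq0⟩
  have h0 : V m 2 = 0 := by
    by_contra hne
    exact hfreq (((h.continuousAt_normal hmW 2).eventually_ne hne).mono fun q hq hq' => hq hq'.1)
  have hl : lam m = 0 := by
    by_contra hne
    have hc : ContinuousAt lam m :=
      h.smooth_lam.continuousOn.continuousAt (h.isOpen.mem_nhds hmW)
    exact hfreq ((hc.eventually_ne hne).mono fun q hq hq' => hq hq'.2)
  have hev := (h.umbilicPatch hι m).eventually_eq_zero hε hN hf (by simp)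
    (map_extChartAt_mem_chartDomain hmW) (by simpa [extChartAt_to_inv] using h0)
    (by simpa [extChartAt_to_inv] using hl)
  rw [mem_interior_iff_mem_nhds]
  filter_upwards [(continuousAt_extChartAt (I := 𝓡 2) m).eventually hev, h.isOpen.mem_nhds hmW,
    extChartAt_source_mem_nhds (I := 𝓡 2) m] with q hq hqW hqs
  refine (h.notMem_transversePoints_iff hε hι hqW).2 ?_
  simpa only [Function.comp_apply, (extChartAt (𝓡 2) m).left_inv hqs] using hq.1

theorem isTotallyGeodesic_of_transversePoints_eq_empty (hε : ε = 1 ∨ ε = -1) (hN : IsOpen N)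
    (hf : ∀ n, ContDiffOn ℝ ∞ (xDeriv n f) N)
    (hι : IsNondegenerateSurface (walkerMetric ε f) N ι)
    (hu : IsTotallyUmbilical (walkerMetric ε f) ι) (ht : transversePoints ι = ∅) :
    IsTotallyGeodesic (walkerMetric ε f) ι := by
  intro m
  obtain ⟨W, V, δ, lam, h, hmW⟩ := hu.exists_isUmbilicOn m
  refine ⟨W, h.isOpen, hmW, V, δ, h.unitNormal, fun q hq T => ?_⟩
  rw [h.umbilic q hq, h.lam_eq_zero hε hN hf hι hq (by simp [ht]), zero_smul]

theorem isParallelFamilySurface_of_transversePoints_eq_empty (hε : ε = 1 ∨ ε = -1)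
    (hN : IsOpen N) (hf : ∀ n, ContDiffOn ℝ ∞ (xDeriv n f) N)
    (hι : IsNondegenerateSurface (walkerMetric ε f) N ι)
    (hu : IsTotallyUmbilical (walkerMetric ε f) ι) (ht : transversePoints ι = ∅) :
    IsParallelFamilySurface ε f 0 ι := by
  intro m
  obtain ⟨W, V, δ, lam, h, hmW⟩ := hu.exists_isUmbilicOn m
  obtain ⟨B, hBD, hB, hmB, a, b, c, d, x, hx, hode, hbij⟩ :=
    (h.umbilicPatch hι m).exists_bijOn_graph hε hN hf (by simp)
      (fun z hz => (h.notMem_transversePoints_iff hε hι hz.2).1 (by simp [ht]))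
      (fun z hz => h.lam_eq_zero hε hN hf hι hz.2 (by simp [ht]))
      (map_extChartAt_mem_chartDomain hmW)
  refine ⟨(extChartAt (𝓡 2) m).source ∩ extChartAt (𝓡 2) m ⁻¹' B,
    isOpen_extChartAt_preimage' m hB, ⟨mem_extChartAt_source m, hmB⟩, a, b, c, d, x, hx, hode, ?_⟩
  have hchart : Set.BijOn (extChartAt (𝓡 2) m)
      ((extChartAt (𝓡 2) m).source ∩ extChartAt (𝓡 2) m ⁻¹' B) B := by
    refine ⟨fun q hq => hq.2, (extChartAt (𝓡 2) m).injOn.mono Set.inter_subset_left,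
      fun z hz => ⟨(extChartAt (𝓡 2) m).symm z, ⟨(extChartAt (𝓡 2) m).map_target (hBD hz).1, ?_⟩,
        (extChartAt (𝓡 2) m).right_inv (hBD hz).1⟩⟩
    rwa [Set.mem_preimage, (extChartAt (𝓡 2) m).right_inv (hBD hz).1]
  refine (hbij.comp hchart).congr fun q hq => ?_
  simp only [Function.comp_apply, (extChartAt (𝓡 2) m).left_inv hq.1]

end Surface

/-! ### The dichotomy -/

theorem theorem1
    (ε : ℝ) (hε : ε = 1 ∨ ε = -1)
    (N : Set Space3) (hN : IsOpen N)
    (f : ℝ → ℝ → ℝ) (hf : ContDiffOn ℝ ∞ (Function.uncurry f) (xyImage N))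
    (hfxx : ∀ U ⊆ N, IsOpen U → U.Nonempty → ∃ p ∈ U, xDeriv 2 f p ≠ 0) :
    -- local conformal flatness means that `f` is quadratic in `x`
    (∀ U ⊆ N, IsOpen U →
      ((walkerMetric ε f).IsLocallyConformallyFlatOn U ↔ ∀ p ∈ U, xDeriv 3 f p = 0)) ∧
    ∀ (M : Type*) [TopologicalSpace M] [ChartedSpace (EuclideanSpace ℝ (Fin 2)) M]
      [IsManifold (𝓡 2) ∞ M] [ConnectedSpace M] (ι : M → Space3),
      IsNondegenerateSurface (walkerMetric ε f) N ι →
      IsTotallyUmbilical (walkerMetric ε f) ι →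
      -- the dichotomy along the surface
      ((IsParallelFamilySurface ε f 0 ι ∧ IsTotallyGeodesic (walkerMetric ε f) ι) ∨
        (IsOpen (transversePoints ι) ∧ Dense (transversePoints ι) ∧
          IsOpen (transverseCylinder N ι) ∧
          (walkerMetric ε f).IsLocallyConformallyFlatOn (transverseCylinder N ι) ∧
          ∀ p ∈ transverseCylinder N ι, xDeriv 3 f p = 0)) ∧
      -- the dichotomy for the whole of `N`, where `N` is of one conformal type
      (((∀ U ⊆ N, IsOpen U → U.Nonempty →
            (walkerMetric ε f).IsLocallyConformallyFlatOn U →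
            (walkerMetric ε f).IsLocallyConformallyFlatOn N) ∨
          (IsConnected N ∧ AnalyticOnNhd ℝ (Function.uncurry f) (xyImage N))) →
        (IsParallelFamilySurface ε f 0 ι ∧ IsTotallyGeodesic (walkerMetric ε f) ι) ∨
        ((walkerMetric ε f).IsLocallyConformallyFlatOn N ∧ ∀ p ∈ N, xDeriv 3 f p = 0)) := by
  have hfn : ∀ n, ContDiffOn ℝ ∞ (xDeriv n f) N := contDiffOn_xDeriv hN hf
  have hflat : ∀ U ⊆ N, IsOpen U →
      ((walkerMetric ε f).IsLocallyConformallyFlatOn U ↔ ∀ p ∈ U, xDeriv 3 f p = 0) :=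
    fun U hUN hU =>
      isLocallyConformallyFlatOn_walkerMetric_iff hε hU fun n => (hfn n).mono hUN
  refine ⟨hflat, fun M _ _ _ _ ι hι hu => ?_⟩
  have hcyl : transverseCylinder N ι ⊆ N := fun p hp => hp.1
  have hcylo := isOpen_transverseCylinder hε hN hι hu
  have hcyl0 : ∀ p ∈ transverseCylinder N ι, xDeriv 3 f p = 0 := fun p =>
    xDeriv_three_eq_zero_of_mem_transverseCylinder hε hN hfn hι hu
  have hclopen : IsClopen (interior (transversePoints ι)ᶜ) :=
    ⟨isClosed_interior_compl_transversePoints hε hN hfn hι hu, isOpen_interior⟩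
  rcases isClopen_iff.1 hclopen with h | h
  · have hdense : Dense (transversePoints ι) := by
      rw [interior_eq_empty_iff_dense_compl, compl_compl] at h
      exact h
    have hcylflat := (hflat _ hcyl hcylo).2 hcyl0
    obtain ⟨m, hm⟩ := hdense.nonempty
    have hne : (transverseCylinder N ι).Nonempty := ⟨ι m, hι.mem m, m, hm, rfl, rfl⟩
    refine ⟨Or.inr ⟨isOpen_transversePoints hε hι hu, hdense, hcylo, hcylflat, hcyl0⟩, ?_⟩
    rintro (htype | ⟨hconn, han⟩)
    · have hNflat := htype _ hcyl hcylo hne hcylflat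
      exact Or.inr ⟨hNflat, (hflat N subset_rfl hN).1 hNflat⟩
    · obtain ⟨p, hp⟩ := hne
      have hz := (analyticOnNhd_xDeriv han hN 3).eqOn_zero_of_preconnected_of_eventuallyEq_zero
        hconn.isPreconnected (hcyl hp)
        (by filter_upwards [hcylo.mem_nhds hp] with q hq using hcyl0 q hq)
      exact Or.inr ⟨(hflat N subset_rfl hN).2 hz, hz⟩
  · have ht : transversePoints ι = ∅ := by
      rw [← Set.compl_univ_iff, ← Set.univ_subset_iff, ← h]
      exact interior_subset
    have h1 := And.intro (isParallelFamilySurface_of_transversePoints_eq_empty hε hN hfn hι hu ht)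
      (isTotallyGeodesic_of_transversePoints_eq_empty hε hN hfn hι hu ht)
    exact ⟨Or.inl h1, fun _ => Or.inl h1⟩
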